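/- Let $n\ge 0$. Equip $\mathbb R^n$ with the Euclidean norm, coordinatewise multiplication $bx=(b_1x_1,\dots,b_nx_n)$, and, for vectors with nonzero coordinates, coordinatewise inverse $b^{-1}$; $B(x,r)$ denotes the closed ball. For $\delta>0$ and a bounded subset $A$ of a metric space, let $\mathcal N_\delta(A)$ be the minimal number of closed balls of radius $\delta$ needed to cover $A$. For bounded $A,A'\subset\mathbb R^n$, the additive energy at scale $\delta$ is $$\omega_\delta(+,A\times A')=\mathcal N_\delta\big(\{((x,y),(x',y'))\in(A\times A')^2 : \|(x+y)-(x'+y')\|\le\delta\}\big),$$ where $(\mathbb R^n\times\mathbb R^n)^2=\mathbb R^{4n}$ carries the Euclidean distance. **Proposition (Additive-Multiplicative Balog–Szemerédi–Gowers).** There is a constant $C>0$ depending only on $n$ such that the following holds for all $K>2$ and all $\delta>0$. Let $X,X',B\subset B(0,K)\subset\mathbb R^n$ with $X'\neq\emptyset$, assume $|b_j|\ge 1/K$ for every $b\in B$ and $j=1,\dots,n$, and let $\mu$ be a Borel probability measure on $B$. Suppose that for every $b\in B$ $$\omega_\delta(+,X\times bX')\ \ge\ \frac1K\,\mathcal N_\delta(X)^{3/2}\,\mathcal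 N_\delta(X')^{3/2}.$$ Then there exist $X_o\subset X$, $b_o\in B$ and a Borel subset $B_1$ of $B$ with $b_o\in B_1\subset B\cap B(b_o,1/K^2)$ such that $$\mathcal N_\delta(X_o)\ge K^{-C}\mathcal N_\delta(X),\qquad \mu(B_1)\ge K^{-C},$$ and for every $b\in b_o^{-1}B_1$ $$\mathcal N_\delta(X_o+bX_o)\le K^{C}\,\mathcal N_\delta(X_o).$$ -/

import Mathlib

open MeasureTheory
open scoped Pointwise

noncomputable section

namespace DiscretizedBSG

/-- `coveringNum δ A`: the minimal number of closed balls of radius `δ` (centred anywhere in the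
ambient space) needed to cover `A`, as a real number. For the bounded subsets of Euclidean spaces
and `δ > 0` considered here, this number is finite. -/
def coveringNum {E : Type*} [PseudoMetricSpace E] (δ : ℝ) (A : Set E) : ℝ :=
  ((Metric.externalCoveringNumber δ.toNNReal A).toNat : ℝ)

/-- The energy of a map `φ : E → F` on a set `A ⊆ E` at scale `δ`: the covering number at scale `δ`
of `{(a, a') ∈ A × A | d(φ a, φ a') ≤ δ}`, where `E × E` carries the distance
`√(d(x, x')² + d(y, y')²)`, that is, the `L²` product distance. -/
def energy {E F : Type*} [PseudoMetricSpace E] [PseudoMetricSpace F] (δ : ℝ) (φ : E → F)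
    (A : Set E) : ℝ :=
  coveringNum δ {p : WithLp 2 (E × E) | p.fst ∈ A ∧ p.snd ∈ A ∧ dist (φ p.fst) (φ p.snd) ≤ δ}

/-- The additive energy of `A` and `B` at scale `δ`: the energy on `A × B` of the addition map
`(a, b) ↦ a + b`, where the product again carries the `L²` product distance. -/
def additiveEnergy {E : Type*} [SeminormedAddCommGroup E] (δ : ℝ) (A B : Set E) : ℝ :=
  energy δ (fun p : WithLp 2 (E × E) => p.fst + p.snd) {p | p.fst ∈ A ∧ p.snd ∈ B}

/-- The coordinatewise product on `ℝⁿ`. -/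
def coordMul {n : ℕ} (b x : EuclideanSpace ℝ (Fin n)) : EuclideanSpace ℝ (Fin n) :=
  WithLp.toLp 2 fun j => b j * x j

/-- The coordinatewise inverse on `ℝⁿ` (used only for vectors with nonzero coordinates). -/
def coordInv {n : ℕ} (b : EuclideanSpace ℝ (Fin n)) : EuclideanSpace ℝ (Fin n) :=
  WithLp.toLp 2 fun j => (b j)⁻¹

/-- The dilated set `b X = {b x | x ∈ X}`. -/
def dilate {n : ℕ} (b : EuclideanSpace ℝ (Fin n)) (X : Set (EuclideanSpace ℝ (Fin n))) :
    Set (EuclideanSpace ℝ (Fin n)) :=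
  coordMul b '' X

end DiscretizedBSG

end

noncomputable section

namespace DiscretizedBSG

open Finset
open scoped Classical

/-! Rounding to a grid of mesh η = δ/(2n+2) replaces covering numbers by cardinalities of subsets of
ℤⁿ. Sums, dilations by the parameters b and additive energies survive the rounding up to n-th powers
of quantities polynomial in K. All of these are absorbed into one number L ≤ K ^ m (`lossBase`), and
every later loss is a power of L.

For a single b, the Balog–Szemerédi–Gowers theorem in ℤⁿ (`balog_szemeredi_gowers`, through paths of
length three in the graph of popular sums) gives dense sets of cells A_b of X and D_b of X' such
that the part of X over A_b plus b times the part of X' over D_b is small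
(`exists_cells_of_energy`). This smallness is stable when b moves by η/K, so A_b and D_b can be
chosen to depend only on the cell of b in a fine grid, and measurability in b is automatic.

One set must then serve many b. The random sets A_b × D_b × {coarse cell of b} have density at least
a power of 1/L, so a second-moment argument (`exists_large_overlap_prod`) gives b₀ and a set of b of
measure at least a power of 1/L for which A_b ∩ A_{b₀} and D_b ∩ D_{b₀} are large and b lies in the
coarse cell of b₀, hence close to b₀.

Let X₀ and X₁ be the parts of X and X' over A_{b₀} and D_{b₀}, and let Y ⊆ X₀, Y' ⊆ X₁ be the parts
over the intersections. Then X₀ + b₀X₁ and Y + bY' are small, and dilating the first by b/b₀ makes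
(b/b₀)X₀ + bX₁ small. Ruzsa's triangle inequality along (b/b₀)X₀, bX₁, bY', Y, X₀ bounds (b/b₀)X₀ +
X₀ (`cellCount_add_dilate_ratio_le`). -/

/-- Splitting a sum according to whether a term exceeds a threshold. -/
theorem sum_le_sum_filter_add {ι : Type*} (S : Finset ι) (f : ι → ℝ) {t : ℝ} (ht : 0 ≤ t) :
    ∑ i ∈ S, f i ≤ ∑ i ∈ S with t ≤ f i, f i + t * #S := by
  rw [← sum_filter_add_sum_filter_not S (fun i => t ≤ f i)]
  gcongr
  calc ∑ i ∈ S with ¬ t ≤ f i, f i ≤ ∑ i ∈ S with ¬ t ≤ f i, t :=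
        sum_le_sum fun i hi => (not_le.1 (mem_filter.1 hi).2).le
    _ = t * #{i ∈ S | ¬ t ≤ f i} := by rw [sum_const, nsmul_eq_mul, mul_comm]
    _ ≤ t * #S := by gcongr; exact filter_subset _ _

/-- A function with a large sum and bounded values is large on a large set. -/
theorem sum_le_mul_card_filter_add {ι : Type*} (S : Finset ι) (f : ι → ℝ) {t m : ℝ} (ht : 0 ≤ t)
    (hm : ∀ i ∈ S, f i ≤ m) :
    ∑ i ∈ S, f i ≤ m * #{i ∈ S | t ≤ f i} + t * #S := by
  refine (sum_le_sum_filter_add S f ht).trans ?_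
  gcongr
  calc ∑ i ∈ S with t ≤ f i, f i ≤ ∑ i ∈ S with t ≤ f i, m :=
        sum_le_sum fun i hi => hm i (mem_filter.1 hi).1
    _ = _ := by rw [sum_const, nsmul_eq_mul, mul_comm]

/-! ### Paths of length three in dense bipartite graphs. -/

section Graph

variable {α β : Type*} (G : α → β → Prop)

theorem card_edges_eq_sum_left (A : Finset α) (B : Finset β) :
    #{p ∈ A ×ˢ B | G p.1 p.2} = ∑ a ∈ A, #{b ∈ B | G a b} := by
  simp only [card_filter, sum_product]

theorem card_edges_eq_sum_right (A : Finset α) (B : Finset β) :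
    #{p ∈ A ×ˢ B | G p.1 p.2} = ∑ b ∈ B, #{a ∈ A | G a b} := by
  simp only [card_filter, sum_product_right]

/-- In a dense bipartite graph, a large subset of one side has few pairs of vertices with few common
neighbours. -/
theorem exists_subset_few_bad_pairs (A : Finset α) {B : Finset β} (hB : B.Nonempty) {L ε : ℝ}
    (hL : 0 < L) (hε : 0 < ε)
    (h : (#A * #B : ℝ) ≤ L * #{p ∈ A ×ˢ B | G p.1 p.2}) :
    ∃ A' ⊆ A, (#A : ℝ) ≤ 2 * L * #A' ∧
      (#{p ∈ A' ×ˢ A' | (#{b ∈ B | G p.1 b ∧ G p.2 b} : ℝ) < ε * #B / (2 * L ^ 2)} : ℝ)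
        ≤ ε * (#A' : ℝ) ^ 2 := by
  set bad : α × α → Prop := fun p => (#{b ∈ B | G p.1 b ∧ G p.2 b} : ℝ) < ε * #B / (2 * L ^ 2)
    with hbad
  set N : β → Finset α := fun b => {a ∈ A | G a b} with hN
  have hBpos : (0 : ℝ) < #B := by exact_mod_cast hB.card_pos
  have h1 : ((#A : ℝ) * #B) ≤ L * ∑ b ∈ B, (#(N b) : ℝ) := by
    rw [card_edges_eq_sum_right] at h
    push_cast at h
    exact h
  -- Cauchy–Schwarz: for b uniform in B, the mean of |N b|² is at least |A|²/L².
  have h2 : (#A : ℝ) ^ 2 * #B ≤ L ^ 2 * ∑ b ∈ B, (#(N b) : ℝ) ^ 2 := by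
    have h3 : (∑ b ∈ B, (#(N b) : ℝ)) ^ 2 ≤ #B * ∑ b ∈ B, (#(N b) : ℝ) ^ 2 :=
      sq_sum_le_card_mul_sum_sq
    have h4 : ((#A : ℝ) * #B) ^ 2 ≤ L ^ 2 * (#B * ∑ b ∈ B, (#(N b) : ℝ) ^ 2) := by
      calc ((#A : ℝ) * #B) ^ 2 ≤ (L * ∑ b ∈ B, (#(N b) : ℝ)) ^ 2 := by gcongr
        _ = L ^ 2 * (∑ b ∈ B, (#(N b) : ℝ)) ^ 2 := by ring
        _ ≤ _ := by gcongr
    have h5 : #B * ((#A : ℝ) ^ 2 * #B) ≤ #B * (L ^ 2 * ∑ b ∈ B, (#(N b) : ℝ) ^ 2) := by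
      nlinarith
    exact le_of_mul_le_mul_left h5 hBpos
  -- Double counting: a bad pair lies in N b only for the few b that are its common neighbours.
  have h3 : ∑ b ∈ B, (#{p ∈ N b ×ˢ N b | bad p} : ℝ) ≤
      (#A : ℝ) ^ 2 * (ε * #B / (2 * L ^ 2)) := by
    have e : ∑ b ∈ B, #{p ∈ N b ×ˢ N b | bad p}
        = ∑ p ∈ A ×ˢ A with bad p, #{b ∈ B | G p.1 b ∧ G p.2 b} := by
      have : ∀ b ∈ B, #{p ∈ N b ×ˢ N b | bad p}
          = #{p ∈ {p ∈ A ×ˢ A | bad p} | G p.1 b ∧ G p.2 b} := by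
        intro b _
        congr 1
        ext p
        simp only [hN, mem_filter, mem_product]
        tauto
      rw [sum_congr rfl this]
      exact sum_card_bipartiteAbove_eq_sum_card_bipartiteBelow
        (fun (b : β) (p : α × α) => G p.1 b ∧ G p.2 b)
    calc ∑ b ∈ B, (#{p ∈ N b ×ˢ N b | bad p} : ℝ)
        = ∑ p ∈ A ×ˢ A with bad p, (#{b ∈ B | G p.1 b ∧ G p.2 b} : ℝ) := by exact_mod_cast e
      _ ≤ ∑ p ∈ A ×ˢ A with bad p, ε * #B / (2 * L ^ 2) :=
          sum_le_sum fun p hp => (mem_filter.1 hp).2.le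
      _ = #{p ∈ A ×ˢ A | bad p} * (ε * #B / (2 * L ^ 2)) := by rw [sum_const, nsmul_eq_mul]
      _ ≤ _ := by
          gcongr
          calc (#{p ∈ A ×ˢ A | bad p} : ℝ) ≤ #(A ×ˢ A) := by gcongr; exact filter_subset _ _
            _ = (#A : ℝ) ^ 2 := by rw [card_product]; push_cast; ring
  -- Dependent random choice: a b that does at least as well as the average of ε|N b|² minus the
  -- number of bad pairs has both a large N b and few bad pairs in it.
  have h4 : ∑ b ∈ B, (ε * (#A : ℝ) ^ 2 / (2 * L ^ 2)) ≤
      ∑ b ∈ B, (ε * (#(N b) : ℝ) ^ 2 - #{p ∈ N b ×ˢ N b | bad p}) := by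
    rw [sum_const, nsmul_eq_mul, sum_sub_distrib, ← mul_sum]
    have h5 : (#A : ℝ) ^ 2 * #B / L ^ 2 ≤ ∑ b ∈ B, (#(N b) : ℝ) ^ 2 := by
      rw [div_le_iff₀ (by positivity)]; linarith
    have h6 : ε * ((#A : ℝ) ^ 2 * #B / L ^ 2) ≤ ε * ∑ b ∈ B, (#(N b) : ℝ) ^ 2 := by gcongr
    have h7 : (#B : ℝ) * (ε * (#A : ℝ) ^ 2 / (2 * L ^ 2))
        = ε * ((#A : ℝ) ^ 2 * #B / L ^ 2) - (#A : ℝ) ^ 2 * (ε * #B / (2 * L ^ 2)) := by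
      field_simp; ring
    rw [h7]; linarith
  obtain ⟨b, hb, hfb⟩ := exists_le_of_sum_le hB h4
  refine ⟨N b, filter_subset _ _, ?_, ?_⟩
  · have h5 : ε * (#A : ℝ) ^ 2 / (2 * L ^ 2) ≤ ε * (#(N b) : ℝ) ^ 2 := by
      have : (0 : ℝ) ≤ #{p ∈ N b ×ˢ N b | bad p} := by positivity
      linarith
    rw [div_le_iff₀ (by positivity)] at h5
    have h6 : (#A : ℝ) ^ 2 ≤ (2 * L * #(N b)) ^ 2 := by
      have : ε * (#A : ℝ) ^ 2 ≤ ε * ((#(N b) : ℝ) ^ 2 * (2 * L ^ 2)) := by linarith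
      have := le_of_mul_le_mul_left this hε
      nlinarith [sq_nonneg (L * #(N b))]
    exact le_of_sq_le_sq h6 (by positivity)
  · have : 0 ≤ ε * (#A : ℝ) ^ 2 / (2 * L ^ 2) := by positivity
    linarith

/-- Graph form of the Balog–Szemerédi–Gowers theorem: a dense bipartite graph contains large vertex
sets any two points of which are joined by many paths of length three. -/
theorem exists_subsets_many_paths {A : Finset α} {B : Finset β} (hA : A.Nonempty) (hB : B.Nonempty)
    {L : ℝ} (hL : 1 ≤ L) (h : (#A * #B : ℝ) ≤ L * #{p ∈ A ×ˢ B | G p.1 p.2}) :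
    ∃ A' ⊆ A, ∃ B' ⊆ B, (#A : ℝ) ≤ 16 * L ^ 2 * #A' ∧ (#B : ℝ) ≤ 4 * L * #B' ∧
      ∀ a ∈ A', ∀ b ∈ B', (#A * #B : ℝ) ≤
        2 ^ 13 * L ^ 6 * #{q ∈ A ×ˢ B | G a q.2 ∧ G q.1 q.2 ∧ G q.1 b} := by
  have hL0 : 0 < L := by linarith
  have hApos : (0 : ℝ) < #A := by exact_mod_cast hA.card_pos
  have hBpos : (0 : ℝ) < #B := by exact_mod_cast hB.card_pos
  -- The discarded vertices carry at most |A||B|/(2L) edges, hence at most half of all edges.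
  set A₁ : Finset α := {a ∈ A | (#B : ℝ) / (2 * L) ≤ #{b ∈ B | G a b}} with hA₁
  have hA₁A : A₁ ⊆ A := filter_subset _ _
  have e1 : (#A₁ * #B : ℝ) ≤ 2 * L * #{p ∈ A₁ ×ˢ B | G p.1 p.2} ∧ (#A : ℝ) ≤ 2 * L * #A₁ := by
    rw [card_edges_eq_sum_left] at h ⊢
    push_cast at h ⊢
    have h1 := sum_le_sum_filter_add A (fun a => (#{b ∈ B | G a b} : ℝ))
      (t := (#B : ℝ) / (2 * L)) (by positivity)
    have h2 := sum_le_mul_card_filter_add A (fun a => (#{b ∈ B | G a b} : ℝ))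
      (t := (#B : ℝ) / (2 * L)) (m := #B) (by positivity)
      (fun a _ => by gcongr; exact filter_subset _ _)
    rw [← hA₁] at h1 h2
    have h3 : L * ((#B : ℝ) / (2 * L) * #A) = #A * #B / 2 := by field_simp
    have h1' := mul_le_mul_of_nonneg_left h1 hL0.le
    have h2' := mul_le_mul_of_nonneg_left h2 hL0.le
    rw [mul_add, h3] at h1' h2'
    have h4 : (#A₁ : ℝ) * #B ≤ #A * #B := by gcongr
    refine ⟨by linarith, ?_⟩
    have : (#A : ℝ) * #B ≤ (2 * L * #A₁) * #B := by linarith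
    exact le_of_mul_le_mul_right this hBpos
  obtain ⟨e1, e1'⟩ := e1
  -- With ε = 1/(16L), at most half of A₂ can have |A₂|/(8L) or more bad partners; the other
  -- vertices form A'.
  obtain ⟨A₂, hA₂, e2, e3⟩ := exists_subset_few_bad_pairs G A₁ hB (L := 2 * L)
    (ε := 1 / (16 * L)) (by positivity) (by positivity) e1
  have hA₂A := hA₂.trans hA₁A
  have e4 : (#A : ℝ) ≤ 8 * L ^ 2 * #A₂ := by nlinarith
  have hA₂pos : (0 : ℝ) < #A₂ := by
    by_contra hc
    have : (#A₂ : ℝ) = 0 := le_antisymm (not_lt.1 hc) (by positivity)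
    rw [this] at e4; linarith
  set t : ℝ := 1 / (16 * L) * #B / (2 * (2 * L) ^ 2) with ht
  set bad : α → α → Prop := fun a a' => (#{b ∈ B | G a b ∧ G a' b} : ℝ) < t with hbad
  set A' : Finset α := {a ∈ A₂ | ¬ (#A₂ : ℝ) / (8 * L) ≤ #{a' ∈ A₂ | bad a a'}} with hA'
  set B' : Finset β := {b ∈ B | (#A₂ : ℝ) / (4 * L) ≤ #{a ∈ A₂ | G a b}} with hB'
  refine ⟨A', (filter_subset _ _).trans hA₂A, B', filter_subset _ _, ?_, ?_, ?_⟩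
  · have h1 : (∑ a ∈ A₂, (#{a' ∈ A₂ | bad a a'} : ℝ)) ≤ 1 / (16 * L) * (#A₂ : ℝ) ^ 2 := by
      have := card_edges_eq_sum_left bad A₂ A₂
      refine le_trans (le_of_eq ?_) e3
      exact_mod_cast this.symm
    have h2 : (#{a ∈ A₂ | (#A₂ : ℝ) / (8 * L) ≤ #{a' ∈ A₂ | bad a a'}} : ℝ) * (#A₂ / (8 * L))
        ≤ ∑ a ∈ A₂, (#{a' ∈ A₂ | bad a a'} : ℝ) := by
      rw [← nsmul_eq_mul, ← sum_const]
      calc _ ≤ ∑ a ∈ A₂ with (#A₂ : ℝ) / (8 * L) ≤ #{a' ∈ A₂ | bad a a'},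
              (#{a' ∈ A₂ | bad a a'} : ℝ) := sum_le_sum fun a ha => (mem_filter.1 ha).2
        _ ≤ _ := sum_le_sum_of_subset_of_nonneg (filter_subset _ _) fun _ _ _ => by positivity
    have h3 : (#{a ∈ A₂ | (#A₂ : ℝ) / (8 * L) ≤ #{a' ∈ A₂ | bad a a'}} : ℝ) ≤ #A₂ / 2 := by
      have h4 := h2.trans h1
      have h5 : 1 / (16 * L) * (#A₂ : ℝ) ^ 2 = #A₂ / 2 * (#A₂ / (8 * L)) := by field_simp; ring
      rw [h5] at h4
      exact le_of_mul_le_mul_right h4 (by positivity)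
    have h4 := card_filter_add_card_filter_not (s := A₂)
      (fun a => (#A₂ : ℝ) / (8 * L) ≤ #{a' ∈ A₂ | bad a a'})
    have h5 : (#{a ∈ A₂ | (#A₂ : ℝ) / (8 * L) ≤ #{a' ∈ A₂ | bad a a'}} : ℝ) + #A' = #A₂ := by
      exact_mod_cast h4
    have h6 : (#A₂ : ℝ) ≤ 2 * #A' := by linarith
    calc (#A : ℝ) ≤ 8 * L ^ 2 * #A₂ := e4
      _ ≤ 8 * L ^ 2 * (2 * #A') := by gcongr
      _ = _ := by ring
  · have h1 : (#A₂ : ℝ) * (#B / (2 * L)) ≤ ∑ b ∈ B, (#{a ∈ A₂ | G a b} : ℝ) := by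
      rw [← Nat.cast_sum, ← card_edges_eq_sum_right, card_edges_eq_sum_left, ← nsmul_eq_mul,
        ← sum_const, Nat.cast_sum]
      exact sum_le_sum fun a ha => (mem_filter.1 (hA₂ ha)).2
    have h2 := sum_le_mul_card_filter_add B (fun b => (#{a ∈ A₂ | G a b} : ℝ))
      (t := (#A₂ : ℝ) / (4 * L)) (m := #A₂) (by positivity)
      (fun a _ => by gcongr; exact filter_subset _ _)
    rw [← hB'] at h2
    have h3 := h1.trans h2
    have h4 : (#A₂ : ℝ) / (4 * L) * #B = #A₂ * (#B / (4 * L)) := by ring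
    have h5 : (#A₂ : ℝ) * (#B / (2 * L)) = #A₂ * (#B / (4 * L)) + #A₂ * (#B / (4 * L)) := by
      field_simp; ring
    rw [h4, h5] at h3
    have h6 : (#A₂ : ℝ) * (#B / (4 * L)) ≤ #A₂ * #B' := by linarith
    have h7 := le_of_mul_le_mul_left h6 hA₂pos
    rw [div_le_iff₀ (by positivity)] at h7
    linarith
  · intro a ha b hb
    have ha' := not_le.1 (mem_filter.1 ha).2
    have hb' := (mem_filter.1 hb).2
    -- Of the at least |A₂|/(4L) neighbours of b in A₂, fewer than |A₂|/(8L) are bad for a. Each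
    -- remaining a' has at least t common neighbours b' with a, giving paths a, b', a', b.
    set S : Finset α := {a' ∈ A₂ | G a' b ∧ ¬ bad a a'} with hS
    have hScard : (#A₂ : ℝ) / (8 * L) ≤ #S := by
      have h1 : #{a' ∈ A₂ | G a' b} ≤ #S + #{a' ∈ A₂ | bad a a'} := by
        refine (card_le_card ?_).trans (card_union_le _ _)
        intro x hx
        simp only [hS, mem_union, mem_filter] at hx ⊢
        tauto
      have h2 : (#{a' ∈ A₂ | G a' b} : ℝ) ≤ #S + #{a' ∈ A₂ | bad a a'} := by exact_mod_cast h1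
      have h3 : (#A₂ : ℝ) / (4 * L) = #A₂ / (8 * L) + #A₂ / (8 * L) := by field_simp; ring
      linarith
    have h1 : (#S : ℝ) * t ≤ #{q ∈ A ×ˢ B | G a q.2 ∧ G q.1 q.2 ∧ G q.1 b} := by
      calc (#S : ℝ) * t = ∑ a' ∈ S, t := by rw [sum_const, nsmul_eq_mul]
        _ ≤ ∑ a' ∈ S, (#{b' ∈ B | G a b' ∧ G a' b'} : ℝ) :=
            sum_le_sum fun a' ha' => not_lt.1 (mem_filter.1 ha').2.2
        _ = #{q ∈ S ×ˢ B | G a q.2 ∧ G q.1 q.2} := by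
            rw [← Nat.cast_sum]; congr 1; simp only [card_filter, sum_product]
        _ ≤ _ := by
            gcongr
            intro q hq
            simp only [hS, mem_filter, mem_product] at hq ⊢
            exact ⟨⟨hA₂A hq.1.1.1, hq.1.2⟩, hq.2.1, hq.2.2, hq.1.1.2.1⟩
    have htpos : 0 < t := by positivity
    have h2 : (#A : ℝ) * #B = 2 ^ 13 * L ^ 6 * ((#A : ℝ) / (64 * L ^ 3) * t) := by
      rw [ht]; field_simp; ring
    rw [h2]
    have h3 : (#A : ℝ) / (64 * L ^ 3) ≤ #S := by
      refine le_trans ?_ hScard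
      rw [div_le_div_iff₀ (by positivity) (by positivity)]
      calc (#A : ℝ) * (8 * L) ≤ (8 * L ^ 2 * #A₂) * (8 * L) := by gcongr
        _ = _ := by ring
    calc _ ≤ 2 ^ 13 * L ^ 6 * (#S * t) := by gcongr
      _ ≤ _ := by gcongr

end Graph

/-! ### From additive energy to small sumsets in abelian groups. -/

/-- The Balog–Szemerédi–Gowers theorem in an abelian group, with polynomial dependence on the
energy constant. -/
theorem balog_szemeredi_gowers {H : Type*} [AddCommGroup H] [DecidableEq H] {A B : Finset H} (hA : A.Nonempty)
    (hB : B.Nonempty) {L : ℝ} (hL : 1 ≤ L)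
    (h : √(#A * #B : ℝ) ^ 3 ≤ L * addEnergy A B) :
    (#A : ℝ) ≤ L ^ 2 * #B ∧
    ∃ A' ⊆ A, ∃ B' ⊆ B, (#A : ℝ) ≤ 2 ^ 6 * L ^ 2 * #A' ∧ (#B : ℝ) ≤ 2 ^ 6 * L ^ 2 * #B' ∧
      (#(A' + B') : ℝ) ≤ 2 ^ 22 * L ^ 10 * #A := by
  have hL0 : 0 < L := by linarith
  have hApos : (0 : ℝ) < #A := by exact_mod_cast hA.card_pos
  have hBpos : (0 : ℝ) < #B := by exact_mod_cast hB.card_pos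
  set s := √(#A * #B : ℝ) with hs
  have hspos : 0 < s := by positivity
  have hs2 : s ^ 2 = #A * #B := Real.sq_sqrt (by positivity)
  set r : H → ℝ := fun x => #{p ∈ A ×ˢ B | p.1 + p.2 = x} with hr
  have hE : (addEnergy A B : ℝ) = ∑ x ∈ A + B, r x ^ 2 := by
    rw [addEnergy_eq_sum_sq']; push_cast; rfl
  have hrsum : ∑ x ∈ A + B, r x = s ^ 2 := by
    rw [hs2, hr, ← Nat.cast_sum, ← Nat.cast_mul, ← card_product]
    congr 1
    exact (card_eq_sum_card_fiberwise fun p hp => by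
      simp only [coe_product, Set.mem_prod, mem_coe] at hp
      exact mem_coe.2 (add_mem_add hp.1 hp.2)).symm
  have hrA : ∀ x, r x ≤ #A := fun x => by
    simp only [hr, Nat.cast_le]
    refine card_le_card_of_injOn Prod.fst (fun p hp => ?_) fun p hp q hq hpq => ?_
    · simp only [coe_filter, mem_product, Set.mem_ofPred_eq] at hp; exact hp.1.1
    · simp only [coe_filter, mem_product, Set.mem_ofPred_eq] at hp hq
      have := hp.2.trans hq.2.symm
      rw [hpq] at this
      exact Prod.ext hpq (add_left_cancel this)
  have hrB : ∀ x, r x ≤ #B := fun x => by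
    simp only [hr, Nat.cast_le]
    refine card_le_card_of_injOn Prod.snd (fun p hp => ?_) fun p hp q hq hpq => ?_
    · simp only [coe_filter, mem_product, Set.mem_ofPred_eq] at hp; exact hp.1.2
    · simp only [coe_filter, mem_product, Set.mem_ofPred_eq] at hp hq
      have := hp.2.trans hq.2.symm
      rw [hpq] at this
      exact Prod.ext (add_right_cancel this) hpq
  have hr0 : ∀ x, 0 ≤ r x := fun x => by positivity
  have hrs : ∀ x, r x ≤ s := fun x => by
    refine le_of_sq_le_sq ?_ hspos.le
    rw [hs2, sq]
    exact mul_le_mul (hrA x) (hrB x) (hr0 x) hApos.le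
  -- The energy is ∑ r² ≤ m ∑ r = m s², while the hypothesis bounds it below by s³/L. With m = |A|
  -- and m = |B| this makes the two sizes comparable.
  have hbound : ∀ m : ℝ, (∀ x, r x ≤ m) → s ≤ L * m := fun m hm => by
    have h1 : ∑ x ∈ A + B, r x ^ 2 ≤ m * s ^ 2 := by
      rw [← hrsum, mul_sum]
      exact sum_le_sum fun x _ => by rw [sq]; exact mul_le_mul_of_nonneg_right (hm x) (hr0 x)
    rw [hE] at h
    have h2 : s ^ 2 * s ≤ s ^ 2 * (L * m) := by
      calc s ^ 2 * s = s ^ 3 := by ring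
        _ ≤ L * (m * s ^ 2) := h.trans (by gcongr)
        _ = _ := by ring
    exact le_of_mul_le_mul_left h2 (by positivity)
  have hsA := hbound _ hrA
  have hsB := hbound _ hrB
  refine ⟨?_, ?_⟩
  · have h1 : s ^ 2 ≤ (L * #B) ^ 2 := by gcongr
    rw [hs2] at h1
    have h2 : #A * (#B : ℝ) ≤ (L ^ 2 * #B) * #B := by linarith
    exact le_of_mul_le_mul_right h2 hBpos
  -- Popular sums: the unpopular ones contribute at most s³/(2L) to the energy, half of its
  -- guaranteed size.
  set S : Finset H := {x ∈ A + B | s / (2 * L) ≤ r x} with hS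
  have hSsum : ∑ x ∈ S, r x ≤ s ^ 2 := by
    rw [← hrsum]
    exact sum_le_sum_of_subset_of_nonneg (filter_subset _ _) fun _ _ _ => hr0 _
  have hScard : (#S : ℝ) ≤ 2 * L * s := by
    have h1 : (#S : ℝ) * (s / (2 * L)) ≤ s ^ 2 := by
      refine le_trans ?_ hSsum
      rw [← nsmul_eq_mul, ← sum_const]
      exact sum_le_sum fun x hx => (mem_filter.1 hx).2
    have h2 : (#S : ℝ) * (s / (2 * L)) ≤ (2 * L * s) * (s / (2 * L)) := by
      refine h1.trans (le_of_eq ?_); field_simp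
    exact le_of_mul_le_mul_right h2 (by positivity)
  have hSlow : s ^ 2 ≤ 2 * L * ∑ x ∈ S, r x := by
    have h1 : ∑ x ∈ A + B, r x ^ 2 ≤ s * ∑ x ∈ S, r x + s / (2 * L) * s ^ 2 := by
      rw [← sum_filter_add_sum_filter_not (A + B) (fun x => s / (2 * L) ≤ r x), ← hS]
      refine add_le_add ?_ ?_
      · rw [mul_sum]
        exact sum_le_sum fun x _ => by
          rw [sq]; exact mul_le_mul_of_nonneg_right (hrs x) (hr0 x)
      · calc ∑ x ∈ A + B with ¬ s / (2 * L) ≤ r x, r x ^ 2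
            ≤ ∑ x ∈ A + B with ¬ s / (2 * L) ≤ r x, s / (2 * L) * r x :=
              sum_le_sum fun x hx => by
                rw [sq]
                exact mul_le_mul_of_nonneg_right (not_le.1 (mem_filter.1 hx).2).le (hr0 x)
          _ ≤ ∑ x ∈ A + B, s / (2 * L) * r x :=
              sum_le_sum_of_subset_of_nonneg (filter_subset _ _) fun x _ _ =>
                mul_nonneg (by positivity) (hr0 x)
          _ = _ := by rw [← mul_sum, hrsum]
    rw [hE] at h
    have h2 : s ^ 3 ≤ L * (s * ∑ x ∈ S, r x) + s ^ 3 / 2 := by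
      refine h.trans ((mul_le_mul_of_nonneg_left h1 hL0.le).trans (le_of_eq ?_))
      field_simp
    have h3 : s * s ^ 2 ≤ s * (2 * L * ∑ x ∈ S, r x) := by nlinarith
    exact le_of_mul_le_mul_left h3 hspos
  obtain ⟨G, hG⟩ : ∃ G : H → H → Prop, ∀ a b, G a b ↔ a + b ∈ S := ⟨_, fun _ _ => Iff.rfl⟩
  have hedges : (#{p ∈ A ×ˢ B | G p.1 p.2} : ℝ) = ∑ x ∈ S, r x := by
    rw [hr, ← Nat.cast_sum]
    congr 1
    rw [card_eq_sum_card_fiberwise (f := fun p : H × H => p.1 + p.2) (t := S)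
      (fun p hp => (hG _ _).1 (mem_filter.1 (mem_coe.1 hp)).2)]
    refine sum_congr rfl fun x hx => ?_
    rw [filter_filter]
    congr 1
    ext p
    simp only [mem_filter, hG]
    constructor
    · rintro ⟨h1, -, h2⟩; exact ⟨h1, h2⟩
    · rintro ⟨h1, rfl⟩; exact ⟨h1, hx, rfl⟩
  obtain ⟨A', hA', B', hB', c1, c2, c3⟩ := exists_subsets_many_paths
    G hA hB (L := 2 * L) (by linarith)
    (by rw [hedges, ← hs2]; exact hSlow)
  refine ⟨A', hA', B', hB', by nlinarith, ?_, ?_⟩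
  · refine c2.trans ?_
    have : 4 * (2 * L) ≤ 2 ^ 6 * L ^ 2 := by nlinarith
    gcongr
  -- A path a, b', a', b writes a + b = (a + b') - (a' + b') + (a' + b) with all three terms in S,
  -- and distinct paths give distinct triples. The constant is 2^13 (2L)^6 = 2^19 L^6.
  have key : #(A' + B') * (s ^ 2 / (2 ^ 19 * L ^ 6)) ≤ (#S : ℝ) ^ 3 := by
    have h1 : (#(S ×ˢ S ×ˢ S) : ℝ) = (#S : ℝ) ^ 3 := by
      rw [card_product, card_product]; push_cast; ring
    have h2 : (∑ x ∈ A' + B', #{q ∈ S ×ˢ S ×ˢ S | q.1 - q.2.1 + q.2.2 = x}) ≤ #(S ×ˢ S ×ˢ S) := by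
      rw [← card_biUnion fun x _ y _ hxy => disjoint_filter.2 fun q _ h h' => hxy (h.symm.trans h')]
      exact card_le_card (biUnion_subset.2 fun x _ => filter_subset _ _)
    rw [← h1, ← nsmul_eq_mul, ← sum_const]
    refine le_trans ?_ (Nat.cast_le.2 h2)
    rw [Nat.cast_sum]
    refine sum_le_sum fun x hx => ?_
    obtain ⟨a, ha, b, hb, rfl⟩ := mem_add.1 hx
    have h3 := c3 a ha b hb
    rw [← hs2] at h3
    have h4 : s ^ 2 / (2 ^ 19 * L ^ 6) ≤
        #{q ∈ A ×ˢ B | G a q.2 ∧ G q.1 q.2 ∧ G q.1 b} := by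
      rw [div_le_iff₀ (by positivity)]
      linarith
    refine h4.trans (Nat.cast_le.2 ?_)
    refine card_le_card_of_injOn (fun q : H × H => (a + q.2, q.1 + q.2, q.1 + b)) ?_ ?_
    · intro q hq
      simp only [coe_filter, mem_product, Set.mem_ofPred_eq, hG] at hq ⊢
      exact ⟨hq.2, by abel⟩
    · intro p _ q _ hpq
      simp only [Prod.mk.injEq, add_right_inj, add_left_inj] at hpq
      exact Prod.ext hpq.2.2 hpq.1
  have h1 : #(A' + B') * (s ^ 2 / (2 ^ 19 * L ^ 6)) ≤
      (2 ^ 22 * L ^ 9 * s) * (s ^ 2 / (2 ^ 19 * L ^ 6)) := by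
    refine (key.trans (pow_le_pow_left₀ (by positivity) hScard 3)).trans (le_of_eq ?_)
    field_simp
  have h2 := le_of_mul_le_mul_right h1 (by positivity)
  calc (#(A' + B') : ℝ) ≤ 2 ^ 22 * L ^ 9 * s := h2
    _ ≤ 2 ^ 22 * L ^ 9 * (L * #A) := by gcongr
    _ = _ := by ring

end DiscretizedBSG

end

noncomputable section

namespace DiscretizedBSG

/-! ### Quadruples whose two sums are only approximately equal. -/

section ShiftedEnergy

open Finset
open scoped Classical

/-- The number of quadruples with prescribed difference of sums is at most the additive energy. -/
theorem card_quadruples_shift_le_addEnergy {H : Type*} [AddCommGroup H] [DecidableEq H] (A B : Finset H) (s : H) :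
    #{x ∈ (A ×ˢ B) ×ˢ A ×ˢ B | x.1.1 + x.1.2 - (x.2.1 + x.2.2) = s} ≤ addEnergy A B := by
  set r : H → ℕ := fun t => #{p ∈ A ×ˢ B | p.1 + p.2 = t} with hr
  have hr0 : ∀ t, t ∉ A + B → r t = 0 := fun t ht => by
    rw [hr]
    refine card_eq_zero.2 (filter_eq_empty_iff.2 fun p hp h => ht ?_)
    rw [← h]
    exact add_mem_add (mem_product.1 hp).1 (mem_product.1 hp).2
  have hE : addEnergy A B = ∑ t ∈ A + B, r t ^ 2 := addEnergy_eq_sum_sq' A B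
  have h1 : #{x ∈ (A ×ˢ B) ×ˢ A ×ˢ B | x.1.1 + x.1.2 - (x.2.1 + x.2.2) = s}
      ≤ ∑ t ∈ A + B, r t * r (t - s) := by
    have hmaps : ∀ x ∈ {x ∈ (A ×ˢ B) ×ˢ A ×ˢ B | x.1.1 + x.1.2 - (x.2.1 + x.2.2) = s},
        x.1.1 + x.1.2 ∈ A + B := fun x hx => by
      simp only [mem_filter, mem_product] at hx
      exact add_mem_add hx.1.1.1 hx.1.1.2
    rw [card_eq_sum_card_fiberwise hmaps]
    refine sum_le_sum fun t _ => ?_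
    rw [hr, ← card_product]
    refine card_le_card fun x hx => ?_
    simp only [mem_filter, mem_product] at hx ⊢
    obtain ⟨⟨⟨h1, h2⟩, h3⟩, h4⟩ := hx
    exact ⟨⟨h1, h4⟩, h2, by rw [← h3, ← h4]; abel⟩
  -- A translate of ∑ r² loses nothing but terms, since r vanishes off A + B; with 2xy ≤ x² + y²
  -- this bounds the correlation of r with its shift.
  have h2 : ∑ t ∈ A + B, r (t - s) ^ 2 ≤ ∑ t ∈ A + B, r t ^ 2 := by
    calc ∑ t ∈ A + B, r (t - s) ^ 2 = ∑ u ∈ (A + B).image (· - s), r u ^ 2 := by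
          rw [sum_image fun x _ y _ h => sub_left_injective h]
      _ ≤ ∑ u ∈ (A + B).image (· - s) ∪ (A + B), r u ^ 2 :=
          sum_le_sum_of_subset subset_union_left
      _ = ∑ t ∈ A + B, r t ^ 2 := by
          refine (sum_subset subset_union_right fun t _ ht => ?_).symm
          rw [hr0 t ht]; rfl
  have h3 : 2 * ∑ t ∈ A + B, r t * r (t - s) ≤
      ∑ t ∈ A + B, r t ^ 2 + ∑ t ∈ A + B, r (t - s) ^ 2 := by
    rw [mul_sum, ← sum_add_distrib]
    refine sum_le_sum fun t _ => ?_
    have := two_mul_le_add_sq (r t) (r (t - s))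
    linarith
  rw [← hE] at h2 h3
  omega

/-- The number of quadruples whose sums differ by an element of a fixed finite set. -/
theorem card_quadruples_near_le {H : Type*} [AddCommGroup H] [DecidableEq H] (A B S : Finset H) :
    #{x ∈ (A ×ˢ B) ×ˢ A ×ˢ B | x.1.1 + x.1.2 - (x.2.1 + x.2.2) ∈ S} ≤ #S * addEnergy A B := by
  have hmaps : ∀ x ∈ {x ∈ (A ×ˢ B) ×ˢ A ×ˢ B | x.1.1 + x.1.2 - (x.2.1 + x.2.2) ∈ S},
      x.1.1 + x.1.2 - (x.2.1 + x.2.2) ∈ S := fun x hx => (mem_filter.1 hx).2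
  rw [card_eq_sum_card_fiberwise hmaps, ← smul_eq_mul, ← sum_const]
  refine sum_le_sum fun s _ => ?_
  refine (card_le_card fun x hx => ?_).trans (card_quadruples_shift_le_addEnergy A B s)
  simp only [mem_filter] at hx ⊢
  exact ⟨hx.1.1, hx.2⟩

end ShiftedEnergy

/-! ### Covering numbers compared with counts of grid cells. -/

section Cells

variable {n : ℕ}

/-- A set of lattice points, each near a member of a finite set, is finite of controlled size. -/
theorem ncard_le_of_near {T F : Set (Fin n → ℤ)} (hF : F.Finite) {R : ℝ}
    (h : ∀ t ∈ T, ∃ g ∈ F, ∀ j, |(t j : ℝ) - g j| ≤ R) (hR : 0 ≤ R) :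
    T.Finite ∧ (T.ncard : ℝ) ≤ (2 * R + 1) ^ n * F.ncard := by
  classical
  set m : ℕ := ⌊R⌋₊ with hm
  set U : Finset (Fin n → ℤ) :=
    hF.toFinset.biUnion fun g => Finset.Icc (fun j => g j - (m : ℤ)) (fun j => g j + (m : ℤ))
    with hU
  have hTU : T ⊆ (U : Set (Fin n → ℤ)) := by
    intro t ht
    obtain ⟨g, hg, hgt⟩ := h t ht
    rw [hU, Finset.mem_coe, Finset.mem_biUnion]
    refine ⟨g, hF.mem_toFinset.2 hg, ?_⟩
    have key : ∀ j, |t j - g j| ≤ (m : ℤ) := by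
      intro j
      have h1 : ((|t j - g j|).toNat : ℝ) ≤ R := by
        have h2 : (((|t j - g j|).toNat : ℤ) : ℝ) = |(t j : ℝ) - g j| := by
          rw [Int.toNat_of_nonneg (abs_nonneg _)]; push_cast; rfl
        have h3 := hgt j
        rw [← h2] at h3
        exact_mod_cast h3
      have h2 : (|t j - g j|).toNat ≤ m := Nat.le_floor h1
      have h3 := abs_nonneg (t j - g j)
      omega
    rw [Finset.mem_Icc]
    constructor
    · intro j
      have := (abs_le.1 (key j)).1
      simp only; omega
    · intro j
      have := (abs_le.1 (key j)).2
      simp only; omega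
  refine ⟨U.finite_toSet.subset hTU, ?_⟩
  have h1 : T.ncard ≤ U.card := by
    rw [← Set.ncard_coe_finset]
    exact Set.ncard_le_ncard hTU U.finite_toSet
  have h2 : U.card ≤ hF.toFinset.card * (2 * m + 1) ^ n := by
    refine Finset.card_biUnion_le_card_mul _ _ _ fun g _ => le_of_eq ?_
    rw [Pi.card_Icc]
    have : ∀ j : Fin n, (Finset.Icc (g j - (m : ℤ)) (g j + (m : ℤ))).card = 2 * m + 1 := by
      intro j
      rw [Int.card_Icc]; omega
    simp [this]
  rw [← Set.ncard_eq_toFinset_card F hF] at h2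
  calc (T.ncard : ℝ) ≤ F.ncard * (2 * m + 1) ^ n := by exact_mod_cast h1.trans h2
    _ ≤ F.ncard * (2 * R + 1) ^ n := by
        gcongr
        exact Nat.floor_le hR
    _ = _ := mul_comm _ _

/-- The index of the cell of the grid of mesh `η` that contains `x`. -/
def latticePt (η : ℝ) (x : EuclideanSpace ℝ (Fin n)) : Fin n → ℤ := fun j => ⌊x j / η⌋

/-- The indices of the grid cells that meet `S`. -/
def cells (η : ℝ) (S : Set (EuclideanSpace ℝ (Fin n))) : Set (Fin n → ℤ) := latticePt η '' S

/-- The number of grid cells that meet `S`. -/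
def cellCount (η : ℝ) (S : Set (EuclideanSpace ℝ (Fin n))) : ℝ := (cells η S).ncard

theorem abs_sub_latticePt_le (η : ℝ) (x : EuclideanSpace ℝ (Fin n)) (j : Fin n) :
    |x j / η - latticePt η x j| ≤ 1 := by
  rw [abs_le, latticePt]
  have h1 := Int.floor_le (x j / η)
  have h2 := Int.lt_floor_add_one (x j / η)
  constructor <;> linarith

theorem cellCount_nonneg (η : ℝ) (S : Set (EuclideanSpace ℝ (Fin n))) : 0 ≤ cellCount η S :=
  Nat.cast_nonneg _

theorem cells_mono (η : ℝ) {S T : Set (EuclideanSpace ℝ (Fin n))} (h : S ⊆ T) :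
    cells η S ⊆ cells η T := Set.image_mono h

theorem cellCount_mono {η : ℝ} {S T : Set (EuclideanSpace ℝ (Fin n))} (hT : (cells η T).Finite)
    (h : S ⊆ T) : cellCount η S ≤ cellCount η T :=
  Nat.cast_le.2 (Set.ncard_le_ncard (cells_mono η h) hT)

theorem cellCount_pos {η : ℝ} {S : Set (EuclideanSpace ℝ (Fin n))} (hS : (cells η S).Finite)
    (h : S.Nonempty) : 0 < cellCount η S :=
  Nat.cast_pos.2 ((Set.ncard_pos hS).2 (h.image _))

/-- Counting cells of a set whose points are near a given finite set of lattice points. -/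
theorem cellCount_le_of_near {η : ℝ} {S : Set (EuclideanSpace ℝ (Fin n))} {F : Set (Fin n → ℤ)}
    (hF : F.Finite) {R : ℝ} (hR : 0 ≤ R)
    (h : ∀ x ∈ S, ∃ g ∈ F, ∀ j, |x j / η - g j| ≤ R) :
    (cells η S).Finite ∧ cellCount η S ≤ (2 * R + 3) ^ n * F.ncard := by
  have := ncard_le_of_near (T := cells η S) hF (R := R + 1) (by
    rintro _ ⟨x, hx, rfl⟩
    obtain ⟨g, hg, hxg⟩ := h x hx
    refine ⟨g, hg, fun j => ?_⟩
    have h1 := hxg j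
    have h2 := abs_sub_latticePt_le η x j
    rw [abs_le] at *
    constructor <;> linarith) (by linarith)
  refine ⟨this.1, this.2.trans (le_of_eq ?_)⟩
  ring

theorem abs_apply_le_norm (x : EuclideanSpace ℝ (Fin n)) (j : Fin n) : |x j| ≤ ‖x‖ := by
  simpa using PiLp.norm_apply_le x j

theorem cells_finite {η r : ℝ} (hη : 0 < η) {S : Set (EuclideanSpace ℝ (Fin n))}
    (h : S ⊆ Metric.closedBall 0 r) : (cells η S).Finite ∧ (0 ≤ r →
      cellCount η S ≤ (2 * (r / η) + 3) ^ n) := by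
  rcases S.eq_empty_or_nonempty with rfl | ⟨x₀, hx₀⟩
  · refine ⟨by simp [cells], fun hr => ?_⟩
    simp only [cellCount, cells, Set.image_empty, Set.ncard_empty, Nat.cast_zero]
    positivity
  have hr : 0 ≤ r := (norm_nonneg x₀).trans (mem_closedBall_zero_iff.1 (h hx₀))
  have := cellCount_le_of_near (η := η) (S := S) (Set.finite_singleton (0 : Fin n → ℤ))
    (R := r / η) (by positivity) (by
      intro x hx
      refine ⟨0, rfl, fun j => ?_⟩
      simp only [Pi.zero_apply, Int.cast_zero, sub_zero]
      rw [abs_div, abs_of_pos hη]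
      gcongr
      exact (abs_apply_le_norm x j).trans (mem_closedBall_zero_iff.1 (h hx)))
  refine ⟨this.1, fun _ => this.2.trans (le_of_eq ?_)⟩
  simp

/-- The cell count is at most a constant times the covering number. -/
theorem cellCount_le_coveringNum {δ r : ℝ} (hδ : 0 < δ) {S : Set (EuclideanSpace ℝ (Fin n))}
    (h : S ⊆ Metric.closedBall 0 r) :
    cellCount (δ / (2 * n + 2)) S ≤ (4 * n + 9) ^ n * coveringNum δ S := by
  obtain ⟨C₀, -, hC₀, hC₀cov⟩ := Metric.exists_finite_isCover_of_totallyBounded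
    (s := S) (ε := δ.toNNReal) (Real.toNNReal_pos.2 hδ).ne'
    ((isCompact_closedBall 0 r).totallyBounded.subset h)
  have : Nonempty {C : Set (EuclideanSpace ℝ (Fin n)) // Metric.IsCover δ.toNNReal S C} :=
    ⟨⟨C₀, hC₀cov⟩⟩
  obtain ⟨C, hC, hCcard⟩ : ∃ C, Metric.IsCover δ.toNNReal S C ∧
      C.encard = Metric.externalCoveringNumber δ.toNNReal S := by
    obtain ⟨⟨C, hC⟩, h1⟩ := ENat.exists_eq_iInf (fun C : {C // Metric.IsCover δ.toNNReal S C} =>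
      (C : Set (EuclideanSpace ℝ (Fin n))).encard)
    refine ⟨C, hC, h1.trans ?_⟩
    exact iInf_subtype (f := fun C : {C // Metric.IsCover δ.toNNReal S C} =>
      (C : Set (EuclideanSpace ℝ (Fin n))).encard)
  have hfin : C.Finite := by
    rw [← Set.encard_lt_top_iff, hCcard]
    exact hC₀cov.externalCoveringNumber_le_encard.trans_lt hC₀.encard_lt_top
  have hcov : coveringNum δ S = C.ncard := by
    rw [coveringNum, ← hCcard]; rfl
  rw [hcov]
  -- In units of the mesh, a δ-ball has radius 2n+2; rounding its centre adds 1.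
  have := (cellCount_le_of_near (η := δ / (2 * n + 2)) (S := S)
    (hfin.image (latticePt (δ / (2 * n + 2)))) (R := 2 * n + 3) (by positivity) (by
      intro x hx
      obtain ⟨c, hc, hxc⟩ := hC hx
      refine ⟨_, ⟨c, hc, rfl⟩, fun j => ?_⟩
      have h1 := abs_sub_latticePt_le (δ / (2 * n + 2)) c j
      have h2 : dist x c ≤ δ := by
        have : edist x c ≤ δ.toNNReal := hxc
        rwa [edist_le_coe, ← NNReal.coe_le_coe, coe_nndist, Real.coe_toNNReal _ hδ.le] at this
      have h3 : |x j / (δ / (2 * n + 2)) - c j / (δ / (2 * n + 2))| ≤ 2 * n + 2 := by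
        rw [← sub_div, abs_div, abs_of_pos (show 0 < δ / (2 * n + 2) by positivity),
          div_le_iff₀ (by positivity)]
        have h4 : |x j - c j| ≤ ‖x - c‖ := abs_apply_le_norm (x - c) j
        rw [← dist_eq_norm] at h4
        refine (h4.trans h2).trans (le_of_eq ?_)
        field_simp
      rw [abs_le] at *
      constructor <;> linarith)).2
  refine this.trans ?_
  have h5 : (2 * (2 * n + 3) + 3 : ℝ) = 4 * n + 9 := by ring
  rw [h5]
  gcongr
  exact Set.ncard_image_le hfin

/-- Bounding a covering number by the number of values of a map with small fibres. -/
theorem coveringNum_le_ncard_image {E ι : Type*} [PseudoMetricSpace E] {δ : ℝ} (hδ : 0 ≤ δ)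
    {S : Set E} (f : E → ι) (hfin : (f '' S).Finite)
    (h : ∀ x ∈ S, ∀ y ∈ S, f x = f y → dist x y ≤ δ) :
    coveringNum δ S ≤ (f '' S).ncard := by
  classical
  obtain ⟨C, hCS, hC⟩ := Set.SurjOn.exists_bijOn_subset (Set.surjOn_image f S)
  have hcover : Metric.IsCover δ.toNNReal S C := by
    intro x hx
    obtain ⟨c, hc, hcx⟩ := hC.surjOn ⟨x, hx, rfl⟩
    refine ⟨c, hc, ?_⟩
    show edist x c ≤ δ.toNNReal
    rw [edist_le_coe, ← NNReal.coe_le_coe, coe_nndist, Real.coe_toNNReal _ hδ]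
    exact h x hx c (hCS hc) hcx.symm
  have h1 := hcover.externalCoveringNumber_le_encard
  have h2 : C.encard = (f '' S).encard := by rw [← hC.image_eq, hC.injOn.encard_image]
  rw [h2, ← hfin.cast_ncard_eq] at h1
  rw [coveringNum, Nat.cast_le]
  exact ENat.toNat_le_of_le_natCast h1

theorem dist_sq_le_of_latticePt_eq {η : ℝ} (hη : 0 < η) {x y : EuclideanSpace ℝ (Fin n)}
    (h : latticePt η x = latticePt η y) : dist x y ^ 2 ≤ n * η ^ 2 := by
  rw [EuclideanSpace.dist_eq, Real.sq_sqrt (by positivity)]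
  calc ∑ i, dist (x i) (y i) ^ 2 ≤ ∑ i : Fin n, η ^ 2 := by
        refine Finset.sum_le_sum fun i _ => ?_
        have h1 : |x i / η - y i / η| < 1 := Int.abs_sub_lt_one_of_floor_eq_floor (congrFun h i)
        rw [← sub_div, abs_div, abs_of_pos hη, div_lt_one hη] at h1
        rw [Real.dist_eq]
        gcongr
    _ = n * η ^ 2 := by simp

/-- The covering number is at most the cell count. -/
theorem coveringNum_le_cellCount {δ : ℝ} (hδ : 0 < δ) {S : Set (EuclideanSpace ℝ (Fin n))}
    (hS : (cells (δ / (2 * n + 2)) S).Finite) :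
    coveringNum δ S ≤ cellCount (δ / (2 * n + 2)) S := by
  refine coveringNum_le_ncard_image hδ.le _ hS fun x _ y _ hxy => ?_
  have h1 := dist_sq_le_of_latticePt_eq (by positivity) hxy
  refine le_of_sq_le_sq (h1.trans ?_) hδ.le
  rw [div_pow, mul_div_assoc', div_le_iff₀ (by positivity), mul_comm]
  gcongr
  nlinarith [Nat.cast_nonneg (α := ℝ) n]

theorem coordMul_apply (b x : EuclideanSpace ℝ (Fin n)) (j : Fin n) : coordMul b x j = b j * x j :=
  rfl

/-- All points of one cell g are sent within R of the vector (b j * g j), hence within R + 1 of its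
integer part, so each cell of S produces boundedly many cells of the dilate. -/
theorem cellCount_dilate_le {η R : ℝ} {S : Set (EuclideanSpace ℝ (Fin n))}
    (hS : (cells η S).Finite) {b : EuclideanSpace ℝ (Fin n)} (hR : 0 ≤ R) (hb : ∀ j, |b j| ≤ R) :
    (cells η (dilate b S)).Finite ∧ cellCount η (dilate b S) ≤ (2 * R + 5) ^ n * cellCount η S := by
  have := cellCount_le_of_near (η := η) (S := dilate b S)
    (hS.image fun g j => ⌊b j * g j⌋) (R := R + 1) (by linarith) (by
      rintro _ ⟨x, hx, rfl⟩
      refine ⟨_, ⟨_, ⟨x, hx, rfl⟩, rfl⟩, fun j => ?_⟩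
      rw [coordMul_apply]
      have h1 := abs_sub_latticePt_le η x j
      have h2 : |b j * x j / η - b j * latticePt η x j| ≤ R := by
        rw [mul_div_assoc, ← mul_sub, abs_mul]
        nlinarith [hb j, abs_nonneg (b j)]
      have h3 := Int.floor_le (b j * latticePt η x j)
      have h4 := Int.lt_floor_add_one (b j * latticePt η x j)
      rw [abs_le] at *
      constructor <;> linarith)
  refine ⟨this.1, this.2.trans ?_⟩
  have h5 : (2 * (R + 1) + 3 : ℝ) = 2 * R + 5 := by ring
  rw [h5, cellCount]
  exact mul_le_mul_of_nonneg_left (Nat.cast_le.2 (Set.ncard_image_le hS)) (by positivity)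

theorem dilate_coordInv_dilate {b : EuclideanSpace ℝ (Fin n)} (hb : ∀ j, b j ≠ 0)
    (S : Set (EuclideanSpace ℝ (Fin n))) : dilate (coordInv b) (dilate b S) = S := by
  rw [dilate, dilate, Set.image_image]
  convert Set.image_id' S with x
  ext j
  simp [coordMul, coordInv, hb j]

theorem cellCount_le_dilate {η R : ℝ} {S : Set (EuclideanSpace ℝ (Fin n))}
    {b : EuclideanSpace ℝ (Fin n)} (hS : (cells η (dilate b S)).Finite)
    (hR : 0 < R) (hb : ∀ j, 1 / R ≤ |b j|) :
    cellCount η S ≤ (2 * R + 5) ^ n * cellCount η (dilate b S) := by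
  have hpos : ∀ j, 0 < |b j| := fun j => (by positivity : 0 < 1 / R).trans_le (hb j)
  have := (cellCount_dilate_le hS (b := coordInv b) hR.le fun j => by
    show |(b j)⁻¹| ≤ R
    rw [abs_inv, inv_le_comm₀ (hpos j) hR, inv_eq_one_div]
    exact hb j).2
  rwa [dilate_coordInv_dilate fun j => abs_pos.1 (hpos j)] at this

/-- Floors are additive up to a bounded error. Together with the converse `ncard_cells_add_le`, this
transfers sumset inequalities from finite subsets of ℤⁿ to cell counts. -/
theorem cells_add_near {η : ℝ} {U V : Set (EuclideanSpace ℝ (Fin n))}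
    (hU : (cells η U).Finite) (hV : (cells η V).Finite) :
    (cells η (U + V)).Finite ∧
      cellCount η (U + V) ≤ 7 ^ n * (cells η U + cells η V).ncard := by
  have := cellCount_le_of_near (η := η) (S := U + V) (hU.add hV) (R := 2) (by norm_num) (by
    rintro _ ⟨x, hx, y, hy, rfl⟩
    refine ⟨_, ⟨_, ⟨x, hx, rfl⟩, _, ⟨y, hy, rfl⟩, rfl⟩, fun j => ?_⟩
    have h1 := abs_sub_latticePt_le η x j
    have h2 := abs_sub_latticePt_le η y j
    simp only [PiLp.add_apply, Pi.add_apply, Int.cast_add, add_div]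
    rw [abs_le] at *
    constructor <;> linarith)
  norm_num at this
  exact this

theorem ncard_cells_add_le {η : ℝ} {U V : Set (EuclideanSpace ℝ (Fin n))}
    (hUV : (cells η (U + V)).Finite) :
    ((cells η U + cells η V).ncard : ℝ) ≤ 7 ^ n * cellCount η (U + V) := by
  have := (ncard_le_of_near (T := cells η U + cells η V) hUV (R := 3) (by
    rintro _ ⟨_, ⟨x, hx, rfl⟩, _, ⟨y, hy, rfl⟩, rfl⟩
    refine ⟨_, ⟨x + y, ⟨x, hx, y, hy, rfl⟩, rfl⟩, fun j => ?_⟩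
    have h1 := abs_sub_latticePt_le η x j
    have h2 := abs_sub_latticePt_le η y j
    have h3 := abs_sub_latticePt_le η (x + y) j
    simp only [PiLp.add_apply, Pi.add_apply, Int.cast_add, add_div] at h3 ⊢
    rw [abs_le] at *
    constructor <;> linarith) (by norm_num)).2
  norm_num at this
  exact this

/-- Ruzsa's triangle inequality for cell counts of sumsets. -/
theorem cellCount_ruzsa {η : ℝ} {U V W : Set (EuclideanSpace ℝ (Fin n))}
    (hU : (cells η U).Finite) (hV : (cells η V).Finite) (hW : (cells η W).Finite) :
    cellCount η (U + W) * cellCount η V ≤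
      (7 ^ n) ^ 3 * (cellCount η (U + V) * cellCount η (V + W)) := by
  classical
  have h1 := (cells_add_near hU hW).2
  have h2 := ncard_cells_add_le (cells_add_near hU hV).1
  have h3 := ncard_cells_add_le (cells_add_near hV hW).1
  have h4 : (cells η U + cells η W).ncard * (cells η V).ncard ≤
      (cells η U + cells η V).ncard * (cells η V + cells η W).ncard := by
    have := Finset.ruzsa_triangle_inequality_add_add_add hU.toFinset hV.toFinset hW.toFinset
    simpa only [← Set.ncard_coe_finset, Finset.coe_add, Set.Finite.coe_toFinset] using this
  have h5 : ((cells η U + cells η W).ncard : ℝ) * cellCount η V ≤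
      (cells η U + cells η V).ncard * (cells η V + cells η W).ncard := by
    rw [cellCount]; exact_mod_cast h4
  have := cellCount_nonneg η V
  have := cellCount_nonneg η (U + V)
  calc cellCount η (U + W) * cellCount η V
      ≤ (7 ^ n * (cells η U + cells η W).ncard) * cellCount η V := by gcongr
    _ = 7 ^ n * ((cells η U + cells η W).ncard * cellCount η V) := by ring
    _ ≤ 7 ^ n * ((cells η U + cells η V).ncard * (cells η V + cells η W).ncard) := by gcongr
    _ ≤ 7 ^ n * ((7 ^ n * cellCount η (U + V)) * (7 ^ n * cellCount η (V + W))) := by gcongr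
    _ = _ := by ring

/-- The additive energy at scale `δ` is bounded by the additive energy of the sets of cells. -/
theorem additiveEnergy_le {δ : ℝ} (hδ : 0 < δ) {X Y : Set (EuclideanSpace ℝ (Fin n))}
    {A B : Finset (Fin n → ℤ)} (hA : (A : Set (Fin n → ℤ)) = cells (δ / (2 * n + 2)) X)
    (hB : (B : Set (Fin n → ℤ)) = cells (δ / (2 * n + 2)) Y) :
    additiveEnergy δ X Y ≤ (4 * n + 13) ^ n * Finset.addEnergy A B := by
  classical
  set η := δ / (2 * n + 2) with hη
  have hηpos : 0 < η := by positivity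
  set f : WithLp 2 (WithLp 2 (EuclideanSpace ℝ (Fin n) × EuclideanSpace ℝ (Fin n)) ×
      WithLp 2 (EuclideanSpace ℝ (Fin n) × EuclideanSpace ℝ (Fin n))) →
      ((Fin n → ℤ) × (Fin n → ℤ)) × ((Fin n → ℤ) × (Fin n → ℤ)) := fun p =>
    ((latticePt η p.fst.fst, latticePt η p.fst.snd), (latticePt η p.snd.fst, latticePt η p.snd.snd))
    with hf
  -- Sums at distance at most δ differ by at most 2n+2 mesh units in each coordinate; four roundings
  -- add 4.
  set S : Finset (Fin n → ℤ) := Finset.Icc (fun _ => -((2 * n + 6 : ℕ) : ℤ))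
    (fun _ => ((2 * n + 6 : ℕ) : ℤ)) with hS
  have hScard : (S.card : ℝ) = (4 * n + 13) ^ n := by
    rw [hS, Pi.card_Icc, Finset.prod_const]
    have : (Finset.Icc (-((2 * n + 6 : ℕ) : ℤ)) ((2 * n + 6 : ℕ) : ℤ)).card = 4 * n + 13 := by
      rw [Int.card_Icc]; omega
    rw [this]; simp
  set Q := {x ∈ (A ×ˢ B) ×ˢ A ×ˢ B | x.1.1 + x.1.2 - (x.2.1 + x.2.2) ∈ S} with hQ
  rw [additiveEnergy, energy]
  set T := {p : WithLp 2 (WithLp 2 (EuclideanSpace ℝ (Fin n) × EuclideanSpace ℝ (Fin n)) ×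
      WithLp 2 (EuclideanSpace ℝ (Fin n) × EuclideanSpace ℝ (Fin n))) |
    p.fst ∈ {p : WithLp 2 (EuclideanSpace ℝ (Fin n) × EuclideanSpace ℝ (Fin n)) |
      p.fst ∈ X ∧ p.snd ∈ Y} ∧
    p.snd ∈ {p : WithLp 2 (EuclideanSpace ℝ (Fin n) × EuclideanSpace ℝ (Fin n)) |
      p.fst ∈ X ∧ p.snd ∈ Y} ∧ dist (p.fst.fst + p.fst.snd) (p.snd.fst + p.snd.snd) ≤ δ} with hT
  have himg : f '' T ⊆ (Q : Set _) := by
    rintro _ ⟨p, ⟨⟨h1, h2⟩, ⟨h3, h4⟩, h5⟩, rfl⟩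
    have hAm : ∀ x ∈ X, latticePt η x ∈ A := fun x hx => by
      rw [← Finset.mem_coe, hA]; exact ⟨x, hx, rfl⟩
    have hBm : ∀ x ∈ Y, latticePt η x ∈ B := fun x hx => by
      rw [← Finset.mem_coe, hB]; exact ⟨x, hx, rfl⟩
    rw [hQ, Finset.mem_coe, Finset.mem_filter]
    refine ⟨Finset.mem_product.2 ⟨Finset.mem_product.2 ⟨hAm _ h1, hBm _ h2⟩,
      Finset.mem_product.2 ⟨hAm _ h3, hBm _ h4⟩⟩, ?_⟩
    have key : ∀ j, |((latticePt η p.fst.fst + latticePt η p.fst.snd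
        - (latticePt η p.snd.fst + latticePt η p.snd.snd)) j : ℝ)| ≤ 2 * n + 6 := by
      intro j
      have e1 := abs_sub_latticePt_le η p.fst.fst j
      have e2 := abs_sub_latticePt_le η p.fst.snd j
      have e3 := abs_sub_latticePt_le η p.snd.fst j
      have e4 := abs_sub_latticePt_le η p.snd.snd j
      rw [dist_eq_norm] at h5
      have e5 := (abs_apply_le_norm _ j).trans h5
      have e6 : |(p.fst.fst j / η + p.fst.snd j / η) - (p.snd.fst j / η + p.snd.snd j / η)|
          ≤ 2 * n + 2 := by
        rw [← add_div, ← add_div, ← sub_div, abs_div, abs_of_pos hηpos, div_le_iff₀ hηpos]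
        refine e5.trans (le_of_eq ?_)
        rw [hη]; field_simp
      simp only [Pi.sub_apply, Pi.add_apply, Int.cast_sub, Int.cast_add]
      rw [abs_le] at *
      constructor <;> linarith
    rw [hS, Finset.mem_Icc]
    constructor
    · intro j
      have := (abs_le.1 (key j)).1
      have h' : -((2 * n + 6 : ℕ) : ℝ) ≤ ((latticePt η p.fst.fst + latticePt η p.fst.snd
        - (latticePt η p.snd.fst + latticePt η p.snd.snd)) j : ℝ) := by push_cast; linarith
      exact_mod_cast h'
    · intro j
      have := (abs_le.1 (key j)).2
      have h' : ((latticePt η p.fst.fst + latticePt η p.fst.snd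
        - (latticePt η p.snd.fst + latticePt η p.snd.snd)) j : ℝ) ≤ ((2 * n + 6 : ℕ) : ℝ) := by
        push_cast; linarith
      exact_mod_cast h'
  have h1 : coveringNum δ T ≤ (f '' T).ncard := by
    refine coveringNum_le_ncard_image hδ.le f (Q.finite_toSet.subset himg) fun p _ q _ hpq => ?_
    simp only [hf, Prod.mk.injEq] at hpq
    obtain ⟨⟨a1, a2⟩, a3, a4⟩ := hpq
    have b1 := dist_sq_le_of_latticePt_eq hηpos a1
    have b2 := dist_sq_le_of_latticePt_eq hηpos a2
    have b3 := dist_sq_le_of_latticePt_eq hηpos a3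
    have b4 := dist_sq_le_of_latticePt_eq hηpos a4
    refine le_of_sq_le_sq ?_ hδ.le
    rw [WithLp.prod_dist_eq_of_L2, Real.sq_sqrt (by positivity), WithLp.prod_dist_eq_of_L2,
      WithLp.prod_dist_eq_of_L2, Real.sq_sqrt (by positivity), Real.sq_sqrt (by positivity)]
    -- A cell of ℝ⁴ⁿ has squared diameter at most 4nη² ≤ (2n+2)²η² = δ², which is what the choice of
    -- mesh ensures.
    have : δ = (2 * n + 2) * η := by rw [hη]; field_simp
    rw [this]
    nlinarith [Nat.cast_nonneg (α := ℝ) n, sq_nonneg η, sq_nonneg (n * η),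
      mul_nonneg (Nat.cast_nonneg (α := ℝ) n) (sq_nonneg η)]
  have h2 : ((f '' T).ncard : ℝ) ≤ Q.card := by
    rw [← Set.ncard_coe_finset]
    exact Nat.cast_le.2 (Set.ncard_le_ncard himg Q.finite_toSet)
  have h3 : (Q.card : ℝ) ≤ S.card * Finset.addEnergy A B := by
    have := card_quadruples_near_le A B S
    have h4 : Q.card ≤ S.card * Finset.addEnergy A B := by
      convert this
    exact_mod_cast h4
  rw [hScard] at h3
  exact h1.trans (h2.trans h3)

end Cells

end DiscretizedBSG

end

noncomputable section

namespace DiscretizedBSG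

/-! ### Overlaps of random dense subsets. -/

section Overlap

open scoped Classical

variable {Ω α : Type*} [MeasurableSpace Ω]

/-- Among large random subsets of a finite set, some one meets many others in a large set. -/
theorem exists_large_overlap [DecidableEq α] (μ : Measure Ω) [IsProbabilityMeasure μ] {T : Finset α}
    {Z : Ω → Finset α} (hZ : ∀ x, MeasurableSet {ω | x ∈ Z ω}) (hZT : ∀ ω, Z ω ⊆ T)
    {L : ℝ} (hL : 1 ≤ L) (h : ∀ ω, (T.card : ℝ) ≤ L * (Z ω).card) :
    ∃ ω₀, MeasurableSet {ω | (T.card : ℝ) ≤ 2 * L ^ 2 * (Z ω₀ ∩ Z ω).card} ∧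
      1 / (2 * L ^ 2) ≤ μ.real {ω | (T.card : ℝ) ≤ 2 * L ^ 2 * (Z ω₀ ∩ Z ω).card} := by
  have hL0 : 0 < L := by linarith
  set e : α → Ω → ℝ := fun x => Set.indicator {ω | x ∈ Z ω} (fun _ => (1 : ℝ)) with he
  have hem : ∀ x, Measurable (e x) := fun x => measurable_const.indicator (hZ x)
  have hei : ∀ x, Integrable (e x) μ := fun x => (integrable_const 1).indicator (hZ x)
  set m : α → ℝ := fun x => ∫ ω, e x ω ∂μ with hm
  have hcard : ∀ ω₀ ω, ((Z ω₀ ∩ Z ω).card : ℝ) = ∑ x ∈ T, e x ω₀ * e x ω := by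
    intro ω₀ ω
    have : Z ω₀ ∩ Z ω = {x ∈ T | x ∈ Z ω₀ ∧ x ∈ Z ω} := by
      ext x
      simp only [Finset.mem_inter, Finset.mem_filter]
      exact ⟨fun hx => ⟨hZT _ hx.1, hx⟩, fun hx => hx.2⟩
    rw [this, Finset.card_filter]
    push_cast
    refine Finset.sum_congr rfl fun x _ => ?_
    simp only [he, Set.indicator_apply, Set.mem_ofPred_eq]
    by_cases h1 : x ∈ Z ω₀ <;> by_cases h2 : x ∈ Z ω <;> simp [h1, h2]
  have hgm : ∀ ω₀, Measurable fun ω => ((Z ω₀ ∩ Z ω).card : ℝ) := fun ω₀ => by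
    simp_rw [hcard]
    exact Finset.measurable_sum _ fun x _ => (hem x).const_mul _
  have hD : ∀ ω₀, MeasurableSet {ω | (T.card : ℝ) ≤ 2 * L ^ 2 * (Z ω₀ ∩ Z ω).card} := fun ω₀ =>
    measurableSet_le measurable_const ((hgm ω₀).const_mul _)
  obtain ⟨ω₁⟩ : Nonempty Ω := nonempty_of_isProbabilityMeasure μ
  rcases T.eq_empty_or_nonempty with rfl | hT
  · refine ⟨ω₁, hD ω₁, ?_⟩
    have : {ω | ((∅ : Finset α).card : ℝ) ≤ 2 * L ^ 2 * (Z ω₁ ∩ Z ω).card} = Set.univ := by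
      refine Set.eq_univ_of_forall fun ω => ?_
      simp only [Finset.card_empty, Nat.cast_zero, Set.mem_ofPred_eq]
      positivity
    rw [this, probReal_univ, div_le_one (by positivity)]
    nlinarith
  have hTpos : (0 : ℝ) < T.card := by exact_mod_cast hT.card_pos
  have h1 : (T.card : ℝ) ≤ L * ∑ x ∈ T, m x := by
    have h2 : ∀ ω, (T.card : ℝ) ≤ L * ∑ x ∈ T, e x ω := fun ω => by
      refine (h ω).trans (mul_le_mul_of_nonneg_left (le_of_eq ?_) hL0.le)
      have := hcard ω ω
      rw [Finset.inter_self] at this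
      rw [this]
      refine Finset.sum_congr rfl fun x _ => ?_
      simp only [he, Set.indicator_apply]
      split_ifs <;> simp
    have h3 := integral_mono (μ := μ) (integrable_const (T.card : ℝ))
      ((integrable_finsetSum T fun x _ => hei x).const_mul L) h2
    rw [integral_const, integral_const_mul, integral_finsetSum T fun x _ => hei x] at h3
    simpa using h3
  -- Cauchy–Schwarz on m x, the probability that x belongs to the random set.
  have h2 : (T.card : ℝ) ≤ L ^ 2 * ∑ x ∈ T, m x ^ 2 := by
    have h3 : (∑ x ∈ T, m x) ^ 2 ≤ T.card * ∑ x ∈ T, m x ^ 2 := sq_sum_le_card_mul_sum_sq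
    have h4 : (T.card : ℝ) ^ 2 ≤ (L * ∑ x ∈ T, m x) ^ 2 := by gcongr
    have h5 : (T.card : ℝ) * T.card ≤ T.card * (L ^ 2 * ∑ x ∈ T, m x ^ 2) := by
      nlinarith [sq_nonneg L]
    exact le_of_mul_le_mul_left h5 hTpos
  -- The function integrated is the expected overlap of Z ω₀ with an independent copy; its mean over
  -- ω₀ is ∑ m².
  obtain ⟨ω₀, hω₀⟩ := exists_integral_le (μ := μ)
    (f := fun ω₀ => ∑ x ∈ T, e x ω₀ * m x) (integrable_finsetSum T fun x _ => (hei x).mul_const _)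
  refine ⟨ω₀, hD ω₀, ?_⟩
  rw [integral_finsetSum T fun x _ => (hei x).mul_const _] at hω₀
  simp only [integral_mul_const] at hω₀
  replace hω₀ : ∑ x ∈ T, m x ^ 2 ≤ ∑ x ∈ T, e x ω₀ * m x :=
    (Finset.sum_congr rfl fun x _ => sq (m x)).trans_le hω₀
  set D := {ω | (T.card : ℝ) ≤ 2 * L ^ 2 * (Z ω₀ ∩ Z ω).card} with hDdef
  -- Overlaps are at most |T| on D and at most |T|/(2L²) off D, the latter being half of the
  -- expected overlap.
  have h3 : ∑ x ∈ T, e x ω₀ * m x ≤ T.card * μ.real D + T.card / (2 * L ^ 2) := by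
    have h4 : ∀ ω, ∑ x ∈ T, e x ω₀ * e x ω ≤
        Set.indicator D (fun _ => (T.card : ℝ)) ω + T.card / (2 * L ^ 2) := fun ω => by
      rw [← hcard]
      by_cases hω : ω ∈ D
      · rw [Set.indicator_of_mem hω]
        have : ((Z ω₀ ∩ Z ω).card : ℝ) ≤ T.card :=
          Nat.cast_le.2 (Finset.card_le_card (Finset.inter_subset_left.trans (hZT _)))
        have : 0 ≤ (T.card : ℝ) / (2 * L ^ 2) := by positivity
        linarith
      · rw [Set.indicator_of_notMem hω, zero_add, le_div_iff₀ (by positivity), mul_comm]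
        exact (not_le.1 hω).le
    have h5 := integral_mono (μ := μ) (integrable_finsetSum T fun x _ => (hei x).const_mul (e x ω₀))
      (((integrable_const (T.card : ℝ)).indicator (hD ω₀)).add
        (integrable_const ((T.card : ℝ) / (2 * L ^ 2)))) h4
    rw [integral_finsetSum T fun x _ => (hei x).const_mul _] at h5
    simp only [integral_const_mul] at h5
    refine h5.trans (le_of_eq ?_)
    simp only [Pi.add_apply]
    rw [integral_add ((integrable_const (T.card : ℝ)).indicator (hD ω₀)) (integrable_const _),
      integral_indicator_const _ (hD ω₀)]
    simp only [integral_const, probReal_univ, smul_eq_mul, one_mul, ← hDdef]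
    ring
  have h4 : (T.card : ℝ) / L ^ 2 ≤ ∑ x ∈ T, m x ^ 2 := by
    rw [div_le_iff₀ (by positivity)]; linarith
  have h5 : (T.card : ℝ) * (1 / (2 * L ^ 2)) ≤ T.card * μ.real D := by
    have : (T.card : ℝ) * (1 / (2 * L ^ 2)) = T.card / L ^ 2 - T.card / (2 * L ^ 2) := by
      field_simp; ring
    rw [this]
    linarith
  exact le_of_mul_le_mul_left h5 hTpos

/-- A version of `exists_large_overlap` for pairs of random subsets, localizing at the same time the
value of a random variable with few values. -/
theorem exists_large_overlap_prod {β γ : Type*} [DecidableEq α] [DecidableEq β] [DecidableEq γ]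
    (μ : Measure Ω) [IsProbabilityMeasure μ] {P : Finset α} {Q : Finset β} {R : Finset γ}
    (hP : P.Nonempty) (hQ : Q.Nonempty) {U : Ω → Finset α} {V : Ω → Finset β} {w : Ω → γ}
    (hm : ∀ x y z, MeasurableSet {ω | (x ∈ U ω ∧ y ∈ V ω) ∧ z = w ω})
    (hU : ∀ ω, U ω ⊆ P) (hV : ∀ ω, V ω ⊆ Q) (hw : ∀ ω, w ω ∈ R) {p q r l : ℝ}
    (hp : 0 ≤ p) (hq : 0 ≤ q) (hl : 1 ≤ l) (hpqr : p * q * r ≤ l)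
    (hUp : ∀ ω, (P.card : ℝ) ≤ p * (U ω).card) (hVq : ∀ ω, (Q.card : ℝ) ≤ q * (V ω).card)
    (hR : (R.card : ℝ) ≤ r) :
    ∃ (ω₀ : Ω) (S : Set Ω), ω₀ ∈ S ∧ MeasurableSet S ∧ 1 / (2 * l ^ 2) ≤ μ.real S ∧
      ∀ ω ∈ S, w ω = w ω₀ ∧ (P.card : ℝ) ≤ 2 * l ^ 2 * (U ω₀ ∩ U ω).card ∧
        (Q.card : ℝ) ≤ 2 * l ^ 2 * (V ω₀ ∩ V ω).card := by
  have hP0 : (0 : ℝ) < P.card := Nat.cast_pos.2 hP.card_pos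
  have hQ0 : (0 : ℝ) < Q.card := Nat.cast_pos.2 hQ.card_pos
  have hl0 : 0 < l := by linarith
  set T := P ×ˢ Q ×ˢ R with hT
  -- Products intersect factorwise: a nonempty overlap forces equal values of w, and a large overlap
  -- forces both other factors to be large.
  set Z : Ω → Finset (α × β × γ) := fun ω => U ω ×ˢ V ω ×ˢ {w ω} with hZ
  have hTcard : (T.card : ℝ) = P.card * (Q.card * R.card) := by
    rw [hT, Finset.card_product, Finset.card_product, Nat.cast_mul, Nat.cast_mul]
  have hZcard : ∀ ω, ((Z ω).card : ℝ) = (U ω).card * (V ω).card := fun ω => by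
    rw [hZ, Finset.card_product, Finset.card_product, Finset.card_singleton, mul_one, Nat.cast_mul]
  have hZm : ∀ x, MeasurableSet {ω | x ∈ Z ω} := fun x => by
    convert hm x.1 x.2.1 x.2.2 using 3 with ω
    simp only [hZ, Finset.mem_product, Finset.mem_singleton, and_assoc]
  have hZT : ∀ ω, Z ω ⊆ T := fun ω =>
    Finset.product_subset_product (hU ω)
      (Finset.product_subset_product (hV ω) (Finset.singleton_subset_iff.2 (hw ω)))
  have hTZ : ∀ ω, (T.card : ℝ) ≤ l * (Z ω).card := fun ω => by
    rw [hTcard, hZcard]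
    calc (P.card : ℝ) * (Q.card * R.card) ≤ (p * (U ω).card) * ((q * (V ω).card) * r) := by
          gcongr
          · exact hUp ω
          · exact hVq ω
      _ = p * q * r * ((U ω).card * (V ω).card) := by ring
      _ ≤ _ := by gcongr
  obtain ⟨ω₀, hS, hμ⟩ := exists_large_overlap μ hZm hZT hl hTZ
  have hR1 : (1 : ℝ) ≤ R.card := Nat.one_le_cast.2 (Finset.card_pos.2 ⟨w ω₀, hw ω₀⟩)
  have hTpos : (0 : ℝ) < T.card := by rw [hTcard]; positivity
  refine ⟨ω₀, _, ?_, hS, hμ, fun ω hω => ?_⟩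
  · rw [Set.mem_ofPred_eq, Finset.inter_self]
    refine (hTZ ω₀).trans (mul_le_mul_of_nonneg_right ?_ (Nat.cast_nonneg _))
    nlinarith
  rw [Set.mem_ofPred_eq] at hω
  have hww : w ω = w ω₀ := by
    by_contra hne
    have : Z ω₀ ∩ Z ω = ∅ := by
      simp only [hZ, Finset.product_inter_product]
      rw [Finset.singleton_inter_of_notMem (by simpa using Ne.symm hne), Finset.product_empty,
        Finset.product_empty]
    rw [this, Finset.card_empty, Nat.cast_zero, mul_zero] at hω
    exact absurd hω (not_le.2 hTpos)
  have hcard : ((Z ω₀ ∩ Z ω).card : ℝ) = (U ω₀ ∩ U ω).card * (V ω₀ ∩ V ω).card := by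
    simp only [hZ, Finset.product_inter_product, hww, Finset.inter_self, Finset.card_product,
      Finset.card_singleton, mul_one, Nat.cast_mul]
  have hUle : ((U ω₀ ∩ U ω).card : ℝ) ≤ P.card :=
    Nat.cast_le.2 (Finset.card_le_card (Finset.inter_subset_left.trans (hU _)))
  have hVle : ((V ω₀ ∩ V ω).card : ℝ) ≤ Q.card :=
    Nat.cast_le.2 (Finset.card_le_card (Finset.inter_subset_left.trans (hV _)))
  have key : (P.card : ℝ) * Q.card ≤
      2 * l ^ 2 * ((U ω₀ ∩ U ω).card * (V ω₀ ∩ V ω).card) := by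
    rw [← hcard]
    refine le_trans ?_ hω
    rw [hTcard, ← mul_assoc]
    exact le_mul_of_one_le_right (by positivity) hR1
  refine ⟨hww, le_of_mul_le_mul_right (key.trans ?_) hQ0, le_of_mul_le_mul_left (key.trans ?_) hP0⟩
  · rw [← mul_assoc]
    exact mul_le_mul_of_nonneg_left hVle (by positivity)
  · rw [mul_left_comm]
    exact mul_le_mul_of_nonneg_right hUle (by positivity)

end Overlap

end DiscretizedBSG

end

/-! ### Bookkeeping of losses, and Balog–Szemerédi–Gowers at scale δ. -/

noncomputable section

namespace DiscretizedBSG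

variable {n : ℕ}

/-- A power of `K` up to constants, dominating all losses caused by the discretization. -/
def lossBase (n : ℕ) (K : ℝ) : ℝ := K * (16 * (n + 1) * K ^ 4) ^ n

theorem pow_le_lossBase {K t : ℝ} (hK : 2 < K) (ht : 0 ≤ t) (h : t ≤ 16 * (n + 1) * K ^ 4) :
    t ^ n ≤ lossBase n K := by
  rw [lossBase]
  calc t ^ n ≤ 1 * (16 * (n + 1) * K ^ 4) ^ n := by rw [one_mul]; gcongr
    _ ≤ _ := by gcongr; linarith

theorem le_lossBase {K : ℝ} (hK : 2 < K) : K ≤ lossBase n K := by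
  have h1 : 1 ≤ (16 * (n + 1) * K ^ 4 : ℝ) ^ n := by
    refine one_le_pow₀ ?_
    have : (1 : ℝ) ≤ K ^ 4 := one_le_pow₀ (by linarith)
    nlinarith [Nat.cast_nonneg (α := ℝ) n]
  rw [lossBase]
  nlinarith

/-- K > 2 turns constants into powers of K: n + 1 ≤ 2 ^ n ≤ K ^ n and 16 ≤ K ^ 4. -/
theorem exists_lossBase_le_pow (n : ℕ) : ∃ m : ℕ, ∀ K : ℝ, 2 < K → lossBase n K ≤ K ^ m := by
  refine ⟨1 + (n + 8) * n, fun K hK => ?_⟩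
  rw [lossBase, pow_add, pow_one, pow_mul]
  have h1 : (n + 1 : ℝ) ≤ K ^ n := by
    have h2 : (n : ℝ) + 1 ≤ 2 ^ n := by exact_mod_cast Nat.lt_two_pow_self (n := n)
    exact h2.trans (pow_le_pow_left₀ (by norm_num) hK.le n)
  have h3 : (16 : ℝ) ≤ K ^ 4 := by
    calc (16 : ℝ) = 2 ^ 4 := by norm_num
      _ ≤ K ^ 4 := by gcongr
  gcongr
  calc 16 * (n + 1) * K ^ 4 ≤ K ^ 4 * K ^ n * K ^ 4 := by gcongr
    _ = K ^ (n + 8) := by ring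

/-- These are the bases of the n-th powers lost below: dilating by b and taking sums, comparing
coverings and energies with cells, dilating by b/b₀, and counting coarse cells of parameters. -/
theorem mul_pow_four_ge {K : ℝ} (hK : 2 < K) :
    16 * K + 16 ≤ 16 * (n + 1) * K ^ 4 ∧ 4 * n + 13 ≤ 16 * (n + 1) * K ^ 4 ∧
      2 * K ^ 2 + 5 ≤ 16 * (n + 1) * K ^ 4 ∧ 2 * ((n + 1) * K ^ 3) + 3 ≤ 16 * (n + 1) * K ^ 4 := by
  have hn : (0 : ℝ) ≤ n := Nat.cast_nonneg n
  have h2 : 4 ≤ K ^ 2 := by nlinarith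
  have h3 : 2 * K ^ 2 ≤ K ^ 3 := by nlinarith [sq_nonneg K]
  have h4 : 2 * K ^ 3 ≤ K ^ 4 := by
    have : K ^ 4 = K * K ^ 3 := by ring
    nlinarith
  have h5 : 2 * K ≤ K ^ 2 := by nlinarith
  have h6 : (n : ℝ) * K ^ 3 ≤ n * K ^ 4 := mul_le_mul_of_nonneg_left (by linarith) hn
  have h7 : (n : ℝ) * 16 ≤ n * K ^ 4 := mul_le_mul_of_nonneg_left (by linarith) hn
  refine ⟨?_, ?_, ?_, ?_⟩ <;> nlinarith

/-- The points of `S` whose cell index belongs to `A`. -/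
def cellRestrict (η : ℝ) (S : Set (EuclideanSpace ℝ (Fin n))) (A : Finset (Fin n → ℤ)) :
    Set (EuclideanSpace ℝ (Fin n)) := {x ∈ S | latticePt η x ∈ A}

theorem cellRestrict_subset (η : ℝ) (S : Set (EuclideanSpace ℝ (Fin n)))
    (A : Finset (Fin n → ℤ)) : cellRestrict η S A ⊆ S := fun _ hx => hx.1

theorem cellRestrict_mono (η : ℝ) (S : Set (EuclideanSpace ℝ (Fin n)))
    {A A' : Finset (Fin n → ℤ)} (h : A ⊆ A') : cellRestrict η S A ⊆ cellRestrict η S A' :=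
  fun _ hx => ⟨hx.1, h hx.2⟩

theorem cells_cellRestrict {η : ℝ} {S : Set (EuclideanSpace ℝ (Fin n))}
    {A : Finset (Fin n → ℤ)} (h : (A : Set (Fin n → ℤ)) ⊆ cells η S) :
    cells η (cellRestrict η S A) = A := by
  ext z
  constructor
  · rintro ⟨x, hx, rfl⟩; exact hx.2
  · intro hz
    obtain ⟨x, hx, rfl⟩ := h hz
    exact ⟨x, ⟨hx, hz⟩, rfl⟩

theorem cellCount_cellRestrict {η : ℝ} {S : Set (EuclideanSpace ℝ (Fin n))}
    {A : Finset (Fin n → ℤ)} (h : (A : Set (Fin n → ℤ)) ⊆ cells η S) :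
    cellCount η (cellRestrict η S A) = A.card := by
  rw [cellCount, cells_cellRestrict h, Set.ncard_coe_finset]

theorem two_pow_mul_le {L : ℝ} (hL : 2 ≤ L) :
    (2 : ℝ) ^ 6 * (L ^ 8) ^ 2 ≤ L ^ 22 ∧ (2 : ℝ) ^ 22 * (L ^ 8) ^ 10 ≤ L ^ 102 := by
  have h0 : (0 : ℝ) ≤ 2 := by norm_num
  have hL0 : 0 ≤ L := h0.trans hL
  have e1 : L ^ 22 = L ^ 6 * (L ^ 8) ^ 2 := by ring
  have e2 : L ^ 102 = L ^ 22 * (L ^ 8) ^ 10 := by ring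
  rw [e1, e2]
  exact ⟨mul_le_mul_of_nonneg_right (pow_le_pow_left₀ h0 hL 6) (by positivity),
    mul_le_mul_of_nonneg_right (pow_le_pow_left₀ h0 hL 22) (by positivity)⟩

/-- The scale-`δ` Balog–Szemerédi–Gowers theorem for a dilated sumset, with a conclusion that is
stable under small perturbations of the dilation. -/
theorem exists_cells_of_energy {K L δ : ℝ} (hK : 2 < K) (hKL : K ≤ L)
    (hpow : ∀ t : ℝ, 0 ≤ t → t ≤ 16 * (n + 1) * K ^ 4 → t ^ n ≤ L) (hδ : 0 < δ)
    {X X' : Set (EuclideanSpace ℝ (Fin n))} (hX : X ⊆ Metric.closedBall 0 K)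
    (hX' : X' ⊆ Metric.closedBall 0 K) (hXne : X.Nonempty) (hX'ne : X'.Nonempty)
    {b : EuclideanSpace ℝ (Fin n)} (hb : ∀ j, 1 / K ≤ |b j|) (hb' : ∀ j, |b j| ≤ K)
    (hen : (1 / K) * coveringNum δ X ^ (3 / 2 : ℝ) * coveringNum δ X' ^ (3 / 2 : ℝ)
      ≤ additiveEnergy δ X (dilate b X')) :
    ∃ A D : Finset (Fin n → ℤ),
      (A : Set (Fin n → ℤ)) ⊆ cells (δ / (2 * n + 2)) X ∧
      (D : Set (Fin n → ℤ)) ⊆ cells (δ / (2 * n + 2)) X' ∧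
      cellCount (δ / (2 * n + 2)) X ≤ L ^ 22 * A.card ∧
      cellCount (δ / (2 * n + 2)) X' ≤ L ^ 24 * D.card ∧
      cellCount (δ / (2 * n + 2)) X ≤ L ^ 17 * cellCount (δ / (2 * n + 2)) X' ∧
      ∀ b' : EuclideanSpace ℝ (Fin n), (∀ j, |b' j - b j| ≤ δ / (2 * n + 2) / K) →
        cellCount (δ / (2 * n + 2)) (cellRestrict (δ / (2 * n + 2)) X A +
          dilate b' (cellRestrict (δ / (2 * n + 2)) X' D)) ≤
            L ^ 103 * cellCount (δ / (2 * n + 2)) X := by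
  classical
  set η := δ / (2 * n + 2) with hη
  have hηpos : 0 < η := by positivity
  have hK0 : 0 < K := by linarith
  obtain ⟨k1, k2, -, -⟩ := mul_pow_four_ge (n := n) hK
  have hL2 : 2 ≤ L := by linarith
  have hL0 : 0 < L := by linarith
  have hL1 : 1 ≤ L := by linarith
  have hXf := (cells_finite hηpos hX).1
  have hX'f := (cells_finite hηpos hX').1
  have c1 : (4 * n + 9 : ℝ) ^ n ≤ L := hpow _ (by positivity) (by linarith)
  have c2 : (4 * n + 13 : ℝ) ^ n ≤ L := hpow _ (by positivity) k2
  have c3 : (2 * K + 5) ^ n ≤ L := hpow _ (by positivity) (by linarith)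
  have c4 : (2 * (K + 3) + 3) ^ n ≤ L := hpow _ (by positivity) (by linarith)
  have hdil := cellCount_dilate_le hX'f hK0.le hb'
  set A₀ := hXf.toFinset with hA₀
  set B₀ := hdil.1.toFinset with hB₀
  have hA₀c : (A₀ : Set (Fin n → ℤ)) = cells η X := hXf.coe_toFinset
  have hB₀c : (B₀ : Set (Fin n → ℤ)) = cells η (dilate b X') := hdil.1.coe_toFinset
  have hA₀card : (A₀.card : ℝ) = cellCount η X := by rw [cellCount, ← hA₀c, Set.ncard_coe_finset]
  have hB₀card : (B₀.card : ℝ) = cellCount η (dilate b X') := by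
    rw [cellCount, ← hB₀c, Set.ncard_coe_finset]
  have hA₀ne : A₀.Nonempty := by
    rw [← Finset.coe_nonempty, hA₀c]; exact hXne.image _
  have hB₀ne : B₀.Nonempty := by
    rw [← Finset.coe_nonempty, hB₀c]; exact (hX'ne.image _).image _
  have hβ : (B₀.card : ℝ) ≤ L * cellCount η X' := by
    rw [hB₀card]
    refine hdil.2.trans ?_
    have := cellCount_nonneg η X'
    gcongr
  have hN : (A₀.card : ℝ) ≤ L * coveringNum δ X := by
    rw [hA₀card]
    refine (cellCount_le_coveringNum hδ hX).trans ?_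
    have : 0 ≤ coveringNum δ X := Nat.cast_nonneg _
    gcongr
  have hN' : (B₀.card : ℝ) ≤ L ^ 2 * coveringNum δ X' := by
    have h1 := cellCount_le_coveringNum hδ hX'
    have : 0 ≤ coveringNum δ X' := Nat.cast_nonneg _
    calc (B₀.card : ℝ) ≤ L * cellCount η X' := hβ
      _ ≤ L * (L * coveringNum δ X') := by
          refine mul_le_mul_of_nonneg_left (h1.trans ?_) hL0.le
          gcongr
      _ = _ := by ring
  -- Passing to cells costs L² on the square root, so L⁶ on its cube; the factor K and the energy
  -- comparison cost one L each.
  have hbsg : √(A₀.card * B₀.card : ℝ) ^ 3 ≤ L ^ 8 * Finset.addEnergy A₀ B₀ := by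
    have hN0 : 0 ≤ coveringNum δ X := Nat.cast_nonneg _
    have hN'0 : 0 ≤ coveringNum δ X' := Nat.cast_nonneg _
    have h1 : √(coveringNum δ X * coveringNum δ X') ^ 3 =
        coveringNum δ X ^ (3 / 2 : ℝ) * coveringNum δ X' ^ (3 / 2 : ℝ) := by
      rw [← Real.mul_rpow hN0 hN'0, Real.sqrt_eq_rpow, ← Real.rpow_natCast,
        ← Real.rpow_mul (mul_nonneg hN0 hN'0)]
      norm_num
    have h2 : √(coveringNum δ X * coveringNum δ X') ^ 3 ≤ K * (L * Finset.addEnergy A₀ B₀) := by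
      rw [h1]
      have h3 := hen.trans (additiveEnergy_le hδ hA₀c hB₀c)
      have h4 : (4 * n + 13 : ℝ) ^ n * Finset.addEnergy A₀ B₀ ≤ L * Finset.addEnergy A₀ B₀ := by
        gcongr
      have h5 := mul_le_mul_of_nonneg_left (h3.trans h4) hK0.le
      refine le_trans (le_of_eq ?_) h5
      field_simp
    have h3 : √(A₀.card * B₀.card : ℝ) ≤ L ^ 2 * √(coveringNum δ X * coveringNum δ X') := by
      rw [Real.sqrt_le_left (by positivity), mul_pow, Real.sq_sqrt (by positivity)]
      calc (A₀.card * B₀.card : ℝ) ≤ (L * coveringNum δ X) * (L ^ 2 * coveringNum δ X') := by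
            gcongr
        _ = L ^ 3 * (coveringNum δ X * coveringNum δ X') := by ring
        _ ≤ (L ^ 2) ^ 2 * (coveringNum δ X * coveringNum δ X') := by
            rw [← pow_mul]; gcongr; norm_num [hL1]
    calc √(A₀.card * B₀.card : ℝ) ^ 3
        ≤ (L ^ 2 * √(coveringNum δ X * coveringNum δ X')) ^ 3 := by gcongr
      _ = L ^ 6 * √(coveringNum δ X * coveringNum δ X') ^ 3 := by ring
      _ ≤ L ^ 6 * (L * (L * Finset.addEnergy A₀ B₀)) := by
          refine mul_le_mul_of_nonneg_left (h2.trans ?_) (by positivity)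
          gcongr
      _ = _ := by ring
  obtain ⟨s1, A, hA, B, hB, s2, s3, s4⟩ :=
    balog_szemeredi_gowers hA₀ne hB₀ne (one_le_pow₀ hL1) hbsg
  obtain ⟨q1, q2⟩ := two_pow_mul_le hL2
  -- B consists of cells of bX'. It is pulled back to points of X', whose own cells form D, so that
  -- both chosen families live in sets independent of b.
  set V : Set (EuclideanSpace ℝ (Fin n)) := {x ∈ X' | latticePt η (coordMul b x) ∈ B} with hV
  have hVX' : V ⊆ X' := fun _ hx => hx.1
  have hVf : (cells η V).Finite := hX'f.subset (cells_mono η hVX')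
  have hBV : cells η (dilate b V) = B := by
    ext z
    constructor
    · rintro ⟨_, ⟨x, hx, rfl⟩, rfl⟩; exact hx.2
    · intro hz
      have hz' : z ∈ cells η (dilate b X') := by rw [← hB₀c]; exact hB hz
      obtain ⟨_, ⟨x, hx, rfl⟩, rfl⟩ := hz'
      exact ⟨_, ⟨x, ⟨hx, hz⟩, rfl⟩, rfl⟩
  refine ⟨A, hVf.toFinset, ?_, ?_, ?_, ?_, ?_, ?_⟩
  · rw [← hA₀c]; exact_mod_cast hA
  · rw [hVf.coe_toFinset]; exact cells_mono η hVX'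
  · rw [← hA₀card]
    refine s2.trans ?_
    gcongr
  · have e1 : (hVf.toFinset.card : ℝ) = cellCount η V := by
      rw [cellCount, Set.ncard_eq_toFinset_card _ hVf]
    have e2 : (B.card : ℝ) ≤ L * cellCount η V := by
      have := (cellCount_dilate_le hVf hK0.le hb').2
      rw [cellCount, hBV, Set.ncard_coe_finset] at this
      refine this.trans ?_
      have := cellCount_nonneg η V
      gcongr
    have e3 := cellCount_le_dilate hdil.1 hK0 hb
    rw [e1]
    calc cellCount η X' ≤ (2 * K + 5) ^ n * B₀.card := by rw [hB₀card]; exact e3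
      _ ≤ L * (L ^ 22 * (L * cellCount η V)) := by
          gcongr
          exact s3.trans (by gcongr)
      _ = _ := by ring
  · rw [← hA₀card]
    calc (A₀.card : ℝ) ≤ (L ^ 8) ^ 2 * B₀.card := s1
      _ ≤ (L ^ 8) ^ 2 * (L * cellCount η X') := by gcongr
      _ = _ := by ring
  · intro b' hbb'
    -- Error budget K + 3: rounding x and bv costs 2, replacing y by v in the same cell costs K, and
    -- replacing b' by b costs 1 because |y j| ≤ K.
    have := (cellCount_le_of_near (η := η) (S := cellRestrict η X A + dilate b'
      (cellRestrict η X' hVf.toFinset)) (A + B).finite_toSet (R := K + 3) (by positivity) (by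
        rintro _ ⟨x, hx, _, ⟨y, hy, rfl⟩, rfl⟩
        obtain ⟨v, hv, hvy⟩ := hVf.mem_toFinset.1 hy.2
        refine ⟨_, Finset.mem_coe.2 (Finset.add_mem_add hx.2 hv.2), fun j => ?_⟩
        have h1 := abs_sub_latticePt_le η x j
        have h2 := abs_sub_latticePt_le η (coordMul b v) j
        have h3 : |v j / η - y j / η| < 1 :=
          Int.abs_sub_lt_one_of_floor_eq_floor (congrFun hvy j)
        have h4 : |b j * (y j / η) - b j * (v j / η)| ≤ K := by
          rw [← mul_sub, abs_mul, abs_sub_comm]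
          nlinarith [hb' j, abs_nonneg (b j)]
        have h5 : |b' j * (y j / η) - b j * (y j / η)| ≤ 1 := by
          rw [← sub_mul, abs_mul, abs_div, abs_of_pos hηpos]
          have h6 : |y j| ≤ K :=
            (abs_apply_le_norm y j).trans (mem_closedBall_zero_iff.1 (hX' hy.1))
          calc |b' j - b j| * (|y j| / η) ≤ (η / K) * (K / η) := by
                gcongr
                exact hbb' j
            _ = 1 := by field_simp
        simp only [PiLp.add_apply, Pi.add_apply, Int.cast_add, add_div, coordMul_apply,
          mul_div_assoc] at h2 ⊢
        rw [abs_le] at *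
        constructor <;> linarith)).2
    rw [Set.ncard_coe_finset] at this
    rw [← hA₀card]
    calc _ ≤ (2 * (K + 3) + 3) ^ n * ((A + B).card : ℝ) := this
      _ ≤ L * (L ^ 102 * A₀.card) := by
          gcongr
          exact s4.trans (by gcongr)
      _ = _ := by ring

end DiscretizedBSG

end

/-! ### Ruzsa calculus for dilated sets. -/

noncomputable section

namespace DiscretizedBSG

variable {n : ℕ}

theorem dilate_mono (b : EuclideanSpace ℝ (Fin n)) {S T : Set (EuclideanSpace ℝ (Fin n))}
    (h : S ⊆ T) : dilate b S ⊆ dilate b T := Set.image_mono h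

theorem dilate_add (b : EuclideanSpace ℝ (Fin n)) (S T : Set (EuclideanSpace ℝ (Fin n))) :
    dilate b (S + T) = dilate b S + dilate b T := by
  have h : ∀ x y, coordMul b (x + y) = coordMul b x + coordMul b y := fun x y => by
    ext j
    simp [coordMul, mul_add]
  exact Set.image_image2_distrib h

theorem dilate_ratio_dilate {b b' : EuclideanSpace ℝ (Fin n)} (hb : ∀ j, b j ≠ 0)
    (S : Set (EuclideanSpace ℝ (Fin n))) :
    dilate (coordMul (coordInv b) b') (dilate b S) = dilate b' S := by
  rw [dilate, dilate, Set.image_image, dilate]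
  refine Set.image_congr fun x _ => ?_
  ext j
  simp only [coordMul, coordInv]
  field_simp [hb j]

theorem abs_ratio_le {K : ℝ} (hK : 0 < K) {b b' : EuclideanSpace ℝ (Fin n)}
    (hb : ∀ j, 1 / K ≤ |b j|) (hb' : ∀ j, |b' j| ≤ K) (j : Fin n) :
    |coordMul (coordInv b) b' j| ≤ K ^ 2 := by
  have e1 : |(b j)⁻¹| ≤ K := by
    rw [abs_inv, inv_le_comm₀ ((by positivity : 0 < 1 / K).trans_le (hb j)) hK, inv_eq_one_div]
    exact hb j
  have e2 : coordMul (coordInv b) b' j = (b j)⁻¹ * b' j := rfl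
  rw [e2, abs_mul, sq]
  exact mul_le_mul e1 (hb' j) (abs_nonneg _) hK.le

/-- Ruzsa's triangle inequality with losses measured by powers of `L`. -/
theorem cellCount_add_le_of_chain {η L a : ℝ} {U V W : Set (EuclideanSpace ℝ (Fin n))}
    (hU : (cells η U).Finite) (hV : (cells η V).Finite) (hW : (cells η W).Finite)
    (ha : 0 < a) (hL : 0 < L) (h7 : (7 : ℝ) ^ n ≤ L) {p q r k : ℕ}
    (hUV : cellCount η (U + V) ≤ L ^ p * a) (hVW : cellCount η (V + W) ≤ L ^ q * a)
    (hr : a ≤ L ^ r * cellCount η V) (hk : 3 + p + q + r = k) :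
    cellCount η (U + W) ≤ L ^ k * a := by
  subst hk
  have h1 := cellCount_ruzsa hU hV hW
  have h2 := cellCount_nonneg η (U + W)
  have h3 := cellCount_nonneg η (U + V)
  have h4 := cellCount_nonneg η (V + W)
  have h5 : cellCount η (U + W) * a ≤ (L ^ (3 + p + q + r) * a) * a := by
    calc cellCount η (U + W) * a ≤ cellCount η (U + W) * (L ^ r * cellCount η V) := by gcongr
      _ = L ^ r * (cellCount η (U + W) * cellCount η V) := by ring
      _ ≤ L ^ r * ((7 ^ n) ^ 3 * (cellCount η (U + V) * cellCount η (V + W))) := by gcongr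
      _ ≤ L ^ r * (L ^ 3 * ((L ^ p * a) * (L ^ q * a))) := by gcongr
      _ = _ := by ring
  exact le_of_mul_le_mul_right h5 ha

/-- The Ruzsa calculus behind the theorem: if `X₀ + b₀ X₁` and `Y + b Y'` are small for large subsets
`Y ⊆ X₀` and `Y' ⊆ X₁`, then `X₀ + (b / b₀) X₀` is small. -/
theorem cellCount_add_dilate_ratio_le {η K L a : ℝ} (hK : 2 < K) (ha : 0 < a) (hL : 1 ≤ L)
    (hpow : ∀ t : ℝ, 0 ≤ t → t ≤ 16 * (n + 1) * K ^ 4 → t ^ n ≤ L)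
    {X₀ X₁ Y Y' : Set (EuclideanSpace ℝ (Fin n))} {b₀ b : EuclideanSpace ℝ (Fin n)}
    (hX₀ : (cells η X₀).Finite) (hX₁ : (cells η X₁).Finite) (hY : Y ⊆ X₀) (hY' : Y' ⊆ X₁)
    (hb₀ : ∀ j, 1 / K ≤ |b₀ j|) (hb₀' : ∀ j, |b₀ j| ≤ K)
    (hb : ∀ j, 1 / K ≤ |b j|) (hb' : ∀ j, |b j| ≤ K)
    (h₀ : cellCount η (X₀ + dilate b₀ X₁) ≤ L ^ 103 * a)
    (h₁ : cellCount η (Y + dilate b Y') ≤ L ^ 103 * a)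
    (hX₀a : a ≤ L ^ 22 * cellCount η X₀) (hX₁a : a ≤ L ^ 41 * cellCount η X₁)
    (hYa : a ≤ L ^ 95 * cellCount η Y) (hY'a : a ≤ L ^ 112 * cellCount η Y') :
    cellCount η (X₀ + dilate (coordMul (coordInv b₀) b) X₀) ≤ L ^ 950 * a := by
  have hK0 : 0 < K := by linarith
  have hL0 : 0 < L := by linarith
  obtain ⟨k1, -, k3, -⟩ := mul_pow_four_ge (n := n) hK
  have c1 : (2 * K + 5) ^ n ≤ L := hpow _ (by positivity) (by linarith)
  have c2 : (2 * K ^ 2 + 5) ^ n ≤ L := hpow _ (by positivity) k3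
  have c3 : (7 : ℝ) ^ n ≤ L := hpow _ (by positivity) (by linarith)
  have hb₀ne : ∀ j, b₀ j ≠ 0 := fun j =>
    abs_pos.1 ((by positivity : 0 < 1 / K).trans_le (hb₀ j))
  have hratio := abs_ratio_le hK0 hb₀ hb'
  have up : ∀ {S : Set (EuclideanSpace ℝ (Fin n))} {d : EuclideanSpace ℝ (Fin n)},
      (cells η S).Finite → (∀ j, |d j| ≤ K) → (cells η (dilate d S)).Finite ∧
        cellCount η (dilate d S) ≤ L * cellCount η S := fun hS hd =>
    have e := cellCount_dilate_le hS hK0.le hd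
    ⟨e.1, e.2.trans (mul_le_mul_of_nonneg_right c1 (cellCount_nonneg _ _))⟩
  have low : ∀ {S : Set (EuclideanSpace ℝ (Fin n))} {d : EuclideanSpace ℝ (Fin n)},
      (cells η (dilate d S)).Finite → (∀ j, 1 / K ≤ |d j|) →
        cellCount η S ≤ L * cellCount η (dilate d S) := fun hS hd =>
    (cellCount_le_dilate hS hK0 hd).trans
      (mul_le_mul_of_nonneg_right c1 (cellCount_nonneg _ _))
  have hYf := hX₀.subset (cells_mono η hY)
  have hY'f := hX₁.subset (cells_mono η hY')
  set E₀ := dilate b₀ X₁ with hE₀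
  have hE₀f : (cells η E₀).Finite := (up hX₁ hb₀').1
  have hbX₁f : (cells η (dilate b X₁)).Finite := (up hX₁ hb').1
  have hbY'f : (cells η (dilate b Y')).Finite := (up hY'f hb').1
  have lift : ∀ {k : ℕ} {S T : Set (EuclideanSpace ℝ (Fin n))}, a ≤ L ^ k * cellCount η S →
      cellCount η S ≤ L * cellCount η T → a ≤ L ^ (k + 1) * cellCount η T := fun {k S T} h h' => by
    calc a ≤ L ^ k * cellCount η S := h
      _ ≤ L ^ k * (L * cellCount η T) := by gcongr
      _ = _ := by ring
  have hE₀a : a ≤ L ^ 42 * cellCount η E₀ := lift hX₁a (low hE₀f hb₀)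
  have hbX₁a : a ≤ L ^ 42 * cellCount η (dilate b X₁) := lift hX₁a (low hbX₁f hb)
  have hbY'a : a ≤ L ^ 113 * cellCount η (dilate b Y') := lift hY'a (low hbY'f hb)
  have s1 : cellCount η (X₀ + X₀) ≤ L ^ 251 * a :=
    cellCount_add_le_of_chain hX₀ hE₀f hX₀ ha hL0 c3 h₀ (by rwa [add_comm]) hE₀a (by norm_num)
  have s2 : cellCount η (E₀ + E₀) ≤ L ^ 231 * a :=
    cellCount_add_le_of_chain hE₀f hX₀ hE₀f ha hL0 c3 (by rwa [add_comm]) h₀ hX₀a (by norm_num)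
  have hX₁X₁f := (cells_add_near hX₁ hX₁).1
  have s3 : cellCount η (X₁ + X₁) ≤ L ^ 232 * a := by
    have e := low (up hX₁X₁f hb₀').1 hb₀
    rw [dilate_add, ← hE₀] at e
    calc cellCount η (X₁ + X₁) ≤ L * cellCount η (E₀ + E₀) := e
      _ ≤ L * (L ^ 231 * a) := by gcongr
      _ = _ := by ring
  have s4 : cellCount η (dilate b X₁ + dilate b Y') ≤ L ^ 233 * a := by
    rw [← dilate_add]
    have e1 : X₁ + Y' ⊆ X₁ + X₁ := Set.add_subset_add_left hY'
    have e := (up (hX₁X₁f.subset (cells_mono η e1)) hb').2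
    calc _ ≤ L * cellCount η (X₁ + Y') := e
      _ ≤ L * (L ^ 232 * a) :=
          mul_le_mul_of_nonneg_left ((cellCount_mono hX₁X₁f e1).trans s3) hL0.le
      _ = _ := by ring
  set W := dilate (coordMul (coordInv b₀) b) X₀ with hW
  have hWf : (cells η W).Finite := (cellCount_dilate_le hX₀ (by positivity) hratio).1
  -- Dilating X₀ + b₀X₁ by b/b₀ gives exactly W + bX₁.
  have s5 : cellCount η (W + dilate b X₁) ≤ L ^ 104 * a := by
    rw [← dilate_ratio_dilate (b' := b) hb₀ne X₁, hW, ← dilate_add]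
    have e := (cellCount_dilate_le (cells_add_near hX₀ hE₀f).1 (by positivity) hratio).2
    calc _ ≤ (2 * K ^ 2 + 5) ^ n * cellCount η (X₀ + E₀) := e
      _ ≤ L * (L ^ 103 * a) :=
          mul_le_mul c2 h₀ (cellCount_nonneg _ _) hL0.le
      _ = _ := by ring
  -- The chain from W to X₀ starts here, with pivots bX₁, bY' and Y in turn; each application adds 3
  -- to the exponents of its inputs.
  have s6 : cellCount η (W + dilate b Y') ≤ L ^ 382 * a :=
    cellCount_add_le_of_chain hWf hbX₁f hbY'f ha hL0 c3 s5 s4 hbX₁a (by norm_num)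
  have s7 : cellCount η (W + Y) ≤ L ^ 601 * a :=
    cellCount_add_le_of_chain hWf hbY'f hYf ha hL0 c3 s6 (by rwa [add_comm]) hbY'a (by norm_num)
  have s8 : cellCount η (Y + X₀) ≤ L ^ 251 * a :=
    (cellCount_mono (cells_add_near hX₀ hX₀).1 (Set.add_subset_add_right hY)).trans s1
  rw [add_comm]
  exact cellCount_add_le_of_chain hWf hYf hX₀ ha hL0 c3 s7 s8 hYa (by norm_num)

end DiscretizedBSG

end

/-! ### Localizing the parameter, and the main construction. -/

noncomputable section

namespace DiscretizedBSG

variable {n : ℕ}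

theorem measurable_latticePt (η : ℝ) :
    Measurable (latticePt η : EuclideanSpace ℝ (Fin n) → Fin n → ℤ) := by
  refine measurable_pi_lambda _ fun j => Int.measurable_floor.comp ?_
  exact (Continuous.measurable (by fun_prop)).div_const η

/-- ℤⁿ is countable, so every condition on the cell of b is measurable. This replaces any measurable
selection of subsets. -/
theorem measurableSet_latticePt_preimage (η : ℝ) (B : Set (EuclideanSpace ℝ (Fin n)))
    (P : (Fin n → ℤ) → Prop) : MeasurableSet {b : B | P (latticePt η b)} :=
  ((measurable_latticePt η).comp measurable_subtype_coe) (Set.to_countable {z | P z}).measurableSet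

/-- The mesh of the grid used to localize the parameter `b`. -/
def localMesh (n : ℕ) (K : ℝ) : ℝ := 1 / ((n + 1) * K ^ 2)

theorem localMesh_pos {K : ℝ} (hK : 2 < K) : 0 < localMesh n K := by
  have : 0 < K := by linarith
  rw [localMesh]; positivity

theorem dist_le_of_localMesh {K : ℝ} (hK : 2 < K) {x y : EuclideanSpace ℝ (Fin n)}
    (h : latticePt (localMesh n K) x = latticePt (localMesh n K) y) : dist x y ≤ 1 / K ^ 2 := by
  have hK0 : 0 < K := by linarith
  refine le_of_sq_le_sq ((dist_sq_le_of_latticePt_eq (localMesh_pos hK) h).trans ?_) (by positivity)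
  have h1 : (n : ℝ) * localMesh n K ^ 2 = n / (n + 1) ^ 2 * (1 / K ^ 2) ^ 2 := by
    rw [localMesh]; field_simp
  rw [h1]
  refine mul_le_of_le_one_left (by positivity) ?_
  rw [div_le_one (by positivity)]
  nlinarith [Nat.cast_nonneg (α := ℝ) n]

theorem cells_localMesh {K L : ℝ} (hK : 2 < K)
    (hpow : ∀ t : ℝ, 0 ≤ t → t ≤ 16 * (n + 1) * K ^ 4 → t ^ n ≤ L)
    {B : Set (EuclideanSpace ℝ (Fin n))} (hB : B ⊆ Metric.closedBall 0 K) :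
    (cells (localMesh n K) B).Finite ∧ cellCount (localMesh n K) B ≤ L := by
  have hK0 : 0 < K := by linarith
  have h := cells_finite (localMesh_pos (n := n) hK) hB
  refine ⟨h.1, (h.2 hK0.le).trans ?_⟩
  have h1 : K / localMesh n K = (n + 1) * K ^ 3 := by
    rw [localMesh]; field_simp
  rw [h1]
  exact hpow _ (by positivity) (mul_pow_four_ge hK).2.2.2

/-- Some set of parameters of small diameter has large measure. -/
theorem exists_localized_set {K L : ℝ} (hK : 2 < K) (hL : 1 ≤ L)
    (hpow : ∀ t : ℝ, 0 ≤ t → t ≤ 16 * (n + 1) * K ^ 4 → t ^ n ≤ L)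
    {B : Set (EuclideanSpace ℝ (Fin n))} (hB : B ⊆ Metric.closedBall 0 K)
    (μ : Measure B) [IsProbabilityMeasure μ] :
    ∃ (b₀ : B) (D : Set B), b₀ ∈ D ∧ MeasurableSet D ∧
      (∀ b ∈ D, dist (b : EuclideanSpace ℝ (Fin n)) b₀ ≤ 1 / K ^ 2) ∧
      1 / (2 * L ^ 2) ≤ μ.real D := by
  classical
  obtain ⟨hf, hcard⟩ := cells_localMesh hK hpow hB
  have hTcard : (hf.toFinset.card : ℝ) ≤ L := by
    rwa [cellCount, Set.ncard_eq_toFinset_card _ hf] at hcard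
  -- Applied to the singleton consisting of the coarse cell of b: a nonempty overlap means the same
  -- cell.
  obtain ⟨b₀, hD, hμ⟩ := exists_large_overlap μ (T := hf.toFinset)
    (Z := fun b : B => {latticePt (localMesh n K) b})
    (fun x => by
      simp only [Finset.mem_singleton]
      exact measurableSet_latticePt_preimage _ B fun z => x = z)
    (fun b => by
      rw [Finset.singleton_subset_iff, Set.Finite.mem_toFinset]
      exact ⟨b, b.2, rfl⟩) hL (fun b => by simpa using hTcard)
  have hTpos : (0 : ℝ) < hf.toFinset.card := by
    refine Nat.cast_pos.2 (Finset.card_pos.2 ⟨latticePt (localMesh n K) b₀, ?_⟩)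
    exact hf.mem_toFinset.2 ⟨b₀, b₀.2, rfl⟩
  refine ⟨b₀, _, ?_, hD, fun b hb => ?_, hμ⟩
  · simp only [Set.mem_ofPred_eq, Finset.inter_self, Finset.card_singleton, Nat.cast_one, mul_one]
    nlinarith
  · refine dist_le_of_localMesh hK ?_
    by_contra hne
    simp only [Set.mem_ofPred_eq] at hb
    rw [Finset.singleton_inter_of_notMem (by simpa using Ne.symm hne), Finset.card_empty,
      Nat.cast_zero, mul_zero] at hb
    exact absurd hb (not_le.2 hTpos)

/-- The main construction, with all losses expressed as powers of `L`. -/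
theorem exists_subset_of_energy {K L δ : ℝ} (hK : 2 < K) (hKL : K ≤ L)
    (hpow : ∀ t : ℝ, 0 ≤ t → t ≤ 16 * (n + 1) * K ^ 4 → t ^ n ≤ L) (hδ : 0 < δ)
    {X X' B : Set (EuclideanSpace ℝ (Fin n))} (hX : X ⊆ Metric.closedBall 0 K)
    (hX' : X' ⊆ Metric.closedBall 0 K) (hB : B ⊆ Metric.closedBall 0 K)
    (hXne : X.Nonempty) (hX'ne : X'.Nonempty) (hb : ∀ b ∈ B, ∀ j : Fin n, 1 / K ≤ |b j|)
    (μ : Measure B) [IsProbabilityMeasure μ]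
    (hen : ∀ b ∈ B, (1 / K) * coveringNum δ X ^ (3 / 2 : ℝ) * coveringNum δ X' ^ (3 / 2 : ℝ)
      ≤ additiveEnergy δ X (dilate b X')) :
    ∃ (X₀ : Set (EuclideanSpace ℝ (Fin n))) (b₀ : B) (D : Set B), X₀ ⊆ X ∧ b₀ ∈ D ∧
      MeasurableSet D ∧ (∀ b ∈ D, dist (b : EuclideanSpace ℝ (Fin n)) b₀ ≤ 1 / K ^ 2) ∧
      coveringNum δ X ≤ L ^ 23 * coveringNum δ X₀ ∧ 1 ≤ L ^ 95 * μ.real D ∧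
      ∀ b ∈ D, coveringNum δ (X₀ + dilate (coordMul (coordInv b₀) b) X₀) ≤
        L ^ 973 * coveringNum δ X₀ := by
  classical
  set η := δ / (2 * n + 2) with hη
  have hηpos : 0 < η := by positivity
  have hK0 : 0 < K := by linarith
  have hL2 : 2 ≤ L := by linarith
  have hL0 : 0 < L := by linarith
  have hL1 : 1 ≤ L := by linarith
  have hXf := (cells_finite hηpos hX).1
  have hX'f := (cells_finite hηpos hX').1
  have hbK : ∀ b ∈ B, ∀ j, |b j| ≤ K := fun b hbB j =>
    (abs_apply_le_norm b j).trans (mem_closedBall_zero_iff.1 (hB hbB))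
  set a := cellCount η X with ha
  set d := cellCount η X' with hd
  have ha1 : 0 < a := cellCount_pos hXf hXne
  have hd1 : 0 < d := cellCount_pos hX'f hX'ne
  -- a choice of large subsets depending only on the fine cell of `b`
  have hchoice : ∀ z : Fin n → ℤ, ∃ A D : Finset (Fin n → ℤ),
      (A : Set (Fin n → ℤ)) ⊆ cells η X ∧ (D : Set (Fin n → ℤ)) ⊆ cells η X' ∧
      ∀ b ∈ B, latticePt (η / K) b = z →
        a ≤ L ^ 22 * A.card ∧ d ≤ L ^ 24 * D.card ∧ a ≤ L ^ 17 * d ∧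
        cellCount η (cellRestrict η X A + dilate b (cellRestrict η X' D)) ≤ L ^ 103 * a := by
    intro z
    by_cases hz : ∃ b ∈ B, latticePt (η / K) b = z
    · obtain ⟨b₁, hb₁, rfl⟩ := hz
      obtain ⟨A, D, h1, h2, h3, h4, h5, h6⟩ :=
        exists_cells_of_energy hK hKL hpow hδ hX hX' hXne hX'ne (hb b₁ hb₁) (hbK b₁ hb₁) (hen b₁ hb₁)
      refine ⟨A, D, h1, h2, fun b _ hbz => ⟨h3, h4, h5, h6 b fun j => ?_⟩⟩
      have e1 : |b j / (η / K) - b₁ j / (η / K)| < 1 :=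
        Int.abs_sub_lt_one_of_floor_eq_floor (congrFun hbz j)
      have e2 : 0 < η / K := by positivity
      rw [← sub_div, abs_div, abs_of_pos e2, div_lt_one e2] at e1
      exact e1.le
    · exact ⟨∅, ∅, by simp, by simp, fun b hbB hbz => absurd ⟨b, hbB, hbz⟩ hz⟩
  choose A D hAX hDX' hAD using hchoice
  obtain ⟨hcf, hccard⟩ := cells_localMesh hK hpow hB
  have hacard : (hXf.toFinset.card : ℝ) = a := by
    rw [ha, cellCount, Set.ncard_eq_toFinset_card _ hXf]
  have hdcard : (hX'f.toFinset.card : ℝ) = d := by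
    rw [hd, cellCount, Set.ncard_eq_toFinset_card _ hX'f]
  have hcL : (hcf.toFinset.card : ℝ) ≤ L := by
    rwa [cellCount, Set.ncard_eq_toFinset_card _ hcf] at hccard
  -- Inverse densities of the three factors: cells of X, cells of X', and one coarse cell among at
  -- most L.
  have e47 : L ^ 22 * L ^ 24 * L ≤ L ^ 47 := le_of_eq (by ring)
  have h95 : 2 * (L ^ 47) ^ 2 ≤ L ^ 95 := by
    have : L ^ 95 = L * (L ^ 47) ^ 2 := by ring
    rw [this]
    exact mul_le_mul_of_nonneg_right hL2 (by positivity)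
  obtain ⟨b₀, S, hb₀S, hS, hμ, hsplit⟩ := exists_large_overlap_prod μ
    (P := hXf.toFinset) (Q := hX'f.toFinset) (R := hcf.toFinset)
    (hXf.toFinset_nonempty.2 (hXne.image _)) (hX'f.toFinset_nonempty.2 (hX'ne.image _))
    (U := fun b : B => A (latticePt (η / K) b)) (V := fun b : B => D (latticePt (η / K) b))
    (w := fun b : B => latticePt (localMesh n K) b)
    (fun x y z => (measurableSet_latticePt_preimage (η / K) B fun t => x ∈ A t ∧ y ∈ D t).inter
      (measurableSet_latticePt_preimage (localMesh n K) B fun t => z = t))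
    (fun b z hz => hXf.mem_toFinset.2 (hAX _ hz)) (fun b z hz => hX'f.mem_toFinset.2 (hDX' _ hz))
    (fun b => hcf.mem_toFinset.2 ⟨b, b.2, rfl⟩) (pow_nonneg hL0.le 22) (pow_nonneg hL0.le 24)
    (one_le_pow₀ hL1) e47 (fun b => by rw [hacard]; exact (hAD _ b b.2 rfl).1)
    (fun b => by rw [hdcard]; exact (hAD _ b b.2 rfl).2.1) hcL
  rw [hacard, hdcard] at hsplit
  set A₀ := A (latticePt (η / K) b₀) with hA₀
  set D₀ := D (latticePt (η / K) b₀) with hD₀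
  obtain ⟨f1, f2, f3, f4⟩ := hAD _ b₀ b₀.2 rfl
  set X₀ := cellRestrict η X A₀ with hX₀
  have hX₀X : X₀ ⊆ X := cellRestrict_subset _ _ _
  have hX₀f := hXf.subset (cells_mono η hX₀X)
  have hX₀card : cellCount η X₀ = A₀.card := cellCount_cellRestrict (hAX _)
  have hX₀cov : cellCount η X₀ ≤ L * coveringNum δ X₀ := by
    refine (cellCount_le_coveringNum hδ (hX₀X.trans hX)).trans ?_
    have h1 : (4 * n + 9 : ℝ) ^ n ≤ L :=
      hpow _ (by positivity) (by linarith [(mul_pow_four_ge (n := n) hK).2.1])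
    exact mul_le_mul_of_nonneg_right h1 (Nat.cast_nonneg _)
  have haX₀ : a ≤ L ^ 22 * cellCount η X₀ := by rw [hX₀card]; exact f1
  refine ⟨X₀, b₀, S, hX₀X, hb₀S, hS, fun b hbS => dist_le_of_localMesh hK (hsplit b hbS).1,
    ?_, ?_, fun b hbS => ?_⟩
  · calc coveringNum δ X ≤ a := coveringNum_le_cellCount hδ hXf
      _ ≤ L ^ 22 * (L * coveringNum δ X₀) := haX₀.trans (by gcongr)
      _ = _ := by ring
  · rw [div_le_iff₀ (by positivity)] at hμ
    rw [mul_comm]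
    exact hμ.trans (mul_le_mul_of_nonneg_left h95 measureReal_nonneg)
  · obtain ⟨-, g1, g2⟩ := hsplit b hbS
    replace g1 := g1.trans (mul_le_mul_of_nonneg_right h95 (Nat.cast_nonneg _))
    replace g2 := g2.trans (mul_le_mul_of_nonneg_right h95 (Nat.cast_nonneg _))
    obtain ⟨-, -, -, g3⟩ := hAD _ b b.2 rfl
    set A₁ := A (latticePt (η / K) b) with hA₁
    set D₁ := D (latticePt (η / K) b) with hD₁
    set X₁ := cellRestrict η X' D₀ with hX₁
    set Y := cellRestrict η X (A₀ ∩ A₁) with hY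
    set Y' := cellRestrict η X' (D₀ ∩ D₁) with hY'
    have hX₁f := hX'f.subset (cells_mono η (cellRestrict_subset η X' D₀))
    have hsubA : ((A₀ ∩ A₁ : Finset (Fin n → ℤ)) : Set (Fin n → ℤ)) ⊆ cells η X :=
      fun z hz => hAX _ (Finset.mem_inter.1 (Finset.mem_coe.1 hz)).1
    have hsubD : ((D₀ ∩ D₁ : Finset (Fin n → ℤ)) : Set (Fin n → ℤ)) ⊆ cells η X' :=
      fun z hz => hDX' _ (Finset.mem_inter.1 (Finset.mem_coe.1 hz)).1
    have key : cellCount η (X₀ + dilate (coordMul (coordInv b₀) b) X₀) ≤ L ^ 950 * a := by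
      refine cellCount_add_dilate_ratio_le (X₁ := X₁) (Y := Y) (Y' := Y') hK ha1 hL1 hpow hX₀f hX₁f
        (cellRestrict_mono _ _ Finset.inter_subset_left)
        (cellRestrict_mono _ _ Finset.inter_subset_left) (hb _ b₀.2) (hbK _ b₀.2) (hb _ b.2)
        (hbK _ b.2) f4 ?_ haX₀ ?_ ?_ ?_
      -- Y and Y' also lie over A₁ and D₁, the sets chosen for b itself, where the sumset with
      -- dilation b is small.
      · refine (cellCount_mono ?_ ?_).trans g3
        · exact (cells_add_near (hXf.subset (cells_mono η (cellRestrict_subset η X A₁)))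
            (cellCount_dilate_le (hX'f.subset (cells_mono η (cellRestrict_subset η X' D₁)))
              hK0.le (hbK _ b.2)).1).1
        · exact Set.add_subset_add (cellRestrict_mono _ _ Finset.inter_subset_right)
            (dilate_mono _ (cellRestrict_mono _ _ Finset.inter_subset_right))
      · rw [cellCount_cellRestrict (hDX' _)]
        calc a ≤ L ^ 17 * (L ^ 24 * D₀.card) := f3.trans (by gcongr)
          _ = _ := by ring
      · rw [cellCount_cellRestrict hsubA]; exact g1
      · rw [cellCount_cellRestrict hsubD]
        calc a ≤ L ^ 17 * (L ^ 95 * (D₀ ∩ D₁).card) := f3.trans (by gcongr)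
          _ = _ := by ring
    have hratio := abs_ratio_le hK0 (hb _ b₀.2) (hbK _ b.2)
    have hfin := (cells_add_near hX₀f (cellCount_dilate_le hX₀f (by positivity) hratio).1).1
    calc _ ≤ _ := coveringNum_le_cellCount hδ hfin
      _ ≤ L ^ 950 * (L ^ 22 * (L * coveringNum δ X₀)) :=
          key.trans (mul_le_mul_of_nonneg_left (haX₀.trans (by gcongr)) (by positivity))
      _ = _ := by ring

end DiscretizedBSG

end

/-! ### The proposition, with losses converted to powers of K. -/

theorem proposition3p7 (n : ℕ) :
    ∃ C : ℝ, 0 < C ∧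
      ∀ (K δ : ℝ), 2 < K → 0 < δ →
      ∀ (X X' B : Set (EuclideanSpace ℝ (Fin n))),
        X ⊆ Metric.closedBall 0 K → X' ⊆ Metric.closedBall 0 K → B ⊆ Metric.closedBall 0 K →
        X'.Nonempty →
        (∀ b ∈ B, ∀ j : Fin n, 1 / K ≤ |b j|) →
      ∀ (μ : Measure B) [IsProbabilityMeasure μ],
        (∀ b ∈ B,
          (1 / K) * DiscretizedBSG.coveringNum δ X ^ (3 / 2 : ℝ)
              * DiscretizedBSG.coveringNum δ X' ^ (3 / 2 : ℝ)
            ≤ DiscretizedBSG.additiveEnergy δ X (DiscretizedBSG.dilate b X')) →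
      ∃ (X₀ : Set (EuclideanSpace ℝ (Fin n))) (b₀ : EuclideanSpace ℝ (Fin n))
        (B₁ : Set (EuclideanSpace ℝ (Fin n))),
        X₀ ⊆ X ∧ b₀ ∈ B ∧ B₁ ⊆ B ∩ Metric.closedBall b₀ (1 / K ^ 2) ∧ b₀ ∈ B₁ ∧
        MeasurableSet ((fun b : B => (b : EuclideanSpace ℝ (Fin n))) ⁻¹' B₁) ∧
        K ^ (-C) * DiscretizedBSG.coveringNum δ X ≤ DiscretizedBSG.coveringNum δ X₀ ∧
        K ^ (-C) ≤ μ.real ((fun b : B => (b : EuclideanSpace ℝ (Fin n))) ⁻¹' B₁) ∧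
        ∀ b ∈ DiscretizedBSG.dilate (DiscretizedBSG.coordInv b₀) B₁,
          DiscretizedBSG.coveringNum δ (X₀ + DiscretizedBSG.dilate b X₀)
            ≤ K ^ C * DiscretizedBSG.coveringNum δ X₀ := by
  obtain ⟨m, hm⟩ := DiscretizedBSG.exists_lossBase_le_pow n
  -- 973 is the largest exponent of L that occurs and L ≤ K ^ m; the extra 1 makes C positive even
  -- if m = 0.
  refine ⟨((m * 973 + 1 : ℕ) : ℝ), by positivity, ?_⟩
  intro K δ hK hδ X X' B hX hX' hB hX'ne hb μ _ hen
  have hK0 : 0 < K := by linarith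
  have hKL := DiscretizedBSG.le_lossBase (n := n) hK
  have hLK := hm K hK
  have hpow : ∀ t : ℝ, 0 ≤ t → t ≤ 16 * (n + 1) * K ^ 4 → t ^ n ≤ DiscretizedBSG.lossBase n K :=
    fun t => DiscretizedBSG.pow_le_lossBase hK
  generalize DiscretizedBSG.lossBase n K = L at hKL hLK hpow
  have hL1 : 1 ≤ L := by linarith
  have hL0 : 0 < L := by linarith
  have hpowle : ∀ k : ℕ, k ≤ 973 → L ^ k ≤ K ^ ((m * 973 + 1 : ℕ) : ℝ) := fun k hk => by
    rw [Real.rpow_natCast]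
    calc L ^ k ≤ L ^ 973 := pow_le_pow_right₀ hL1 hk
      _ ≤ (K ^ m) ^ 973 := pow_le_pow_left₀ hL0.le hLK _
      _ = K ^ (m * 973) := (pow_mul _ _ _).symm
      _ ≤ _ := pow_le_pow_right₀ (by linarith) (Nat.le_succ _)
  have hneg : ∀ (k : ℕ) (x y : ℝ), k ≤ 973 → 0 ≤ y → x ≤ L ^ k * y →
      K ^ (-((m * 973 + 1 : ℕ) : ℝ)) * x ≤ y := fun k x y hk hy hxy => by
    rw [Real.rpow_neg hK0.le, inv_mul_le_iff₀ (by positivity)]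
    exact hxy.trans (mul_le_mul_of_nonneg_right (hpowle k hk) hy)
  have main : ∃ (X₀ : Set (EuclideanSpace ℝ (Fin n))) (b₀ : B) (D : Set B), X₀ ⊆ X ∧ b₀ ∈ D ∧
      MeasurableSet D ∧ (∀ b ∈ D, dist (b : EuclideanSpace ℝ (Fin n)) b₀ ≤ 1 / K ^ 2) ∧
      DiscretizedBSG.coveringNum δ X ≤ L ^ 23 * DiscretizedBSG.coveringNum δ X₀ ∧
      1 ≤ L ^ 95 * μ.real D ∧
      ∀ b ∈ D, DiscretizedBSG.coveringNum δ (X₀ + DiscretizedBSG.dilate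
        (DiscretizedBSG.coordMul (DiscretizedBSG.coordInv b₀) b) X₀) ≤
          L ^ 973 * DiscretizedBSG.coveringNum δ X₀ := by
    -- For empty X all covering bounds are trivial, and only a localized set of parameters of large
    -- measure is needed.
    rcases X.eq_empty_or_nonempty with rfl | hXne
    · obtain ⟨b₀, D, h1, h2, h3, h4⟩ :=
        DiscretizedBSG.exists_localized_set hK hL1 hpow hB μ
      refine ⟨∅, b₀, D, subset_rfl, h1, h2, h3, ?_, ?_, fun b _ => ?_⟩
      · simp [DiscretizedBSG.coveringNum]
      · rw [div_le_iff₀ (by positivity), mul_comm] at h4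
        refine h4.trans (mul_le_mul_of_nonneg_right ?_ measureReal_nonneg)
        calc 2 * L ^ 2 ≤ L * L ^ 2 := mul_le_mul_of_nonneg_right (by linarith) (by positivity)
          _ = L ^ 3 := by ring
          _ ≤ L ^ 95 := pow_le_pow_right₀ hL1 (by norm_num)
      · simp [DiscretizedBSG.coveringNum]
    · exact DiscretizedBSG.exists_subset_of_energy hK hKL hpow hδ hX hX' hB hXne hX'ne hb μ hen
  obtain ⟨X₀, b₀, D, h1, h2, h3, h4, h5, h6, h7⟩ := main
  have hpre : (fun b : B => (b : EuclideanSpace ℝ (Fin n))) ⁻¹'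
      ((fun b : B => (b : EuclideanSpace ℝ (Fin n))) '' D) = D :=
    Set.preimage_image_eq _ Subtype.val_injective
  refine ⟨X₀, b₀, (fun b : B => (b : EuclideanSpace ℝ (Fin n))) '' D, h1, b₀.2, ?_, ⟨b₀, h2, rfl⟩,
    ?_, ?_, ?_, ?_⟩
  · rintro _ ⟨b, hbD, rfl⟩
    exact ⟨b.2, h4 b hbD⟩
  · rw [hpre]; exact h3
  · exact hneg 23 _ _ (by norm_num) (Nat.cast_nonneg _) h5
  · rw [hpre]
    simpa using hneg 95 1 _ (by norm_num) measureReal_nonneg h6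
  · rintro _ ⟨_, ⟨b, hbD, rfl⟩, rfl⟩
    exact (h7 b hbD).trans (mul_le_mul_of_nonneg_right (hpowle 973 le_rfl) (Nat.cast_nonneg _))
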